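/- Let $1\le p\le\infty$ and let $L^p(\mathbb R^+)$, $\mathbb R^+=(0,\infty)$, be identified with the subspace of the complex space $L^p(\mathbb R)$ of functions vanishing on $\mathbb R^-=(-\infty,0)$. Let $P$ and $Q$ be the projections of $L^p(\mathbb R)$ onto $L^p(\mathbb R^+)$ and $L^p(\mathbb R^-)$ (multiplication by the indicator functions), and $(Jf)(t)=\tilde f(t)=f(-t)$. Let $G$ be the algebra of all functions $$a(t)=\sum_j a_je^{i\delta_jt}+\int_{-\infty}^\infty k(s)e^{its}\,ds,\qquad t\in\mathbb R,$$ with pairwise distinct $\delta_j\in\mathbb R$, $\sum_j|a_j|<\infty$ and $k\in L^1(\mathbb R)$; let $G^+$ (resp. $G^-$) be the subalgebra of those $a$ for which all $\delta_j\ge0$ and $k$ vanishes on $\mathbb R^-$ (resp. all $\delta_j\le0$ and $k$ vanishes on $\mathbb R^+$). For $a\in G$ set $$(W^0(a)f)(t)=\sum_ja_jf(t-\delta_j)+\int_{-\infty}^\infty k(t-s)f(s)\,ds\quad(f\in L^p(\mathbb R)),\qquad W(a)f=PW^0(a)f\quad(f\in L^p(\mathbb R^+)).$$ For $a\in G$ invertible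 in $G$, with almost periodic part $b(t)=\sum_ja_je^{i\delta_jt}$ and $\hat k=a-b$, put $$\nu(a)=\lim_{l\to\infty}\frac1{2l}[\arg b(t)]_{-l}^{l},\qquad n(a)=\frac1{2\pi}[\arg(1+b^{-1}(t)\hat k(t))]_{t=-\infty}^{\infty}.$$ Let $g\in G$ satisfy $g\tilde g=1$, $\nu(g)=0$ and $n(g)=-1$, and set $\xi(g)=(-1)^{n(g)}g(0)=-g(0)$. Then $g$ admits a factorization $$g(t)=g_-(t)\Big(\frac{t-i}{t+i}\Big)^{-1}g_+(t),\qquad g_+^{\pm1}\in G^+,\quad g_-^{\pm1}\in G^-,$$ with $g_-(0)=1$. For every factorization of this form (normalized by $g_-(0)=1$ or not), with $\psi_0(t)=e^{-t}$, $t>0$: 1. $\ker W(g)\subset L^p(\mathbb R^+)$ is one-dimensional and $\ker W(g)=\{\mathbf c\,W(g_+^{-1})\psi_0:\mathbf c\in\mathbb C\}$; 2. the operators $\mathbf P^{\pm}(g)=\frac12(I\pm\mathbf P(g))$ on $\ker W(g)$, where $\mathbf P(g)=JQW^0(g)P|_{\ker W(g)}$, satisfy $$\operatorname{im}\mathbf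 P^{\pm}(g)=\Big\{\mathbf c\,\Big(\frac{1\mp\xi(g)}2\Big)W(g_+^{-1})\psi_0:\mathbf c\in\mathbb C\Big\}.$$ -/

import Mathlib

open MeasureTheory
open scoped ENNReal

namespace WienerHopf

noncomputable section

/-! ### Boundedness of convolution by an integrable function on `L^p(ℝ)`, `1 ≤ p ≤ ∞` -/

theorem lintegral_conv_rpow_le {q : ℝ} (hq : 1 ≤ q) {k f : ℝ → ℂ}
    (hk : AEStronglyMeasurable k volume) (hf : AEStronglyMeasurable f volume) :
    ∫⁻ t, (∫⁻ s, ‖k s‖ₑ * ‖f (t - s)‖ₑ) ^ q ≤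
      (∫⁻ s, ‖k s‖ₑ) ^ q * ∫⁻ t, ‖f t‖ₑ ^ q := by
  set M : ℝ≥0∞ := ∫⁻ s, ‖k s‖ₑ with hM
  have hq0 : 0 < q := by linarith
  have hft : ∀ t : ℝ, AEStronglyMeasurable (fun s => f (t - s)) volume := fun t =>
    hf.comp_quasiMeasurePreserving (quasiMeasurePreserving_sub_left volume t)
  have hpt : ∀ t : ℝ, (∫⁻ s, ‖k s‖ₑ * ‖f (t - s)‖ₑ) ^ q ≤
      M ^ (q - 1) * ∫⁻ s, ‖k s‖ₑ * ‖f (t - s)‖ₑ ^ q := by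
    intro t
    set ν : Measure ℝ := volume.withDensity (fun s => ‖k s‖ₑ) with hν
    have hνac : ν ≪ volume := withDensity_absolutelyContinuous _ _
    have h1 := eLpNorm_le_eLpNorm_mul_rpow_measure_univ (μ := ν) (p := 1) (q := ENNReal.ofReal q)
      (by simpa using hq) ((hft t).mono_ac hνac)
    rw [eLpNorm_one_eq_lintegral_enorm, eLpNorm_eq_lintegral_rpow_enorm_toReal (by simpa using hq0)
      ENNReal.ofReal_ne_top, ENNReal.toReal_ofReal hq0.le, hν,
      lintegral_withDensity_eq_lintegral_mul₀ hk.enorm (hft t).enorm,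
      lintegral_withDensity_eq_lintegral_mul₀ hk.enorm ((hft t).enorm.pow_const q),
      withDensity_apply _ MeasurableSet.univ, Measure.restrict_univ, ← hM] at h1
    have h2 := ENNReal.rpow_le_rpow h1 hq0.le
    rw [ENNReal.mul_rpow_of_nonneg _ _ hq0.le, ← ENNReal.rpow_mul, ← ENNReal.rpow_mul,
      one_div_mul_cancel hq0.ne', ENNReal.rpow_one] at h2
    have h3 : (1 / (1 : ℝ≥0∞).toReal - 1 / q) * q = q - 1 := by
      simp; field_simp
    rw [h3] at h2
    exact h2.trans (le_of_eq (mul_comm _ _))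
  have hmeas : AEMeasurable (Function.uncurry fun t s : ℝ => ‖k s‖ₑ * ‖f (t - s)‖ₑ ^ q)
      ((volume : Measure ℝ).prod volume) := by
    refine AEMeasurable.mul ?_ (AEMeasurable.pow_const ?_ q)
    · exact hk.comp_snd.enorm
    · exact (hf.comp_quasiMeasurePreserving (quasiMeasurePreserving_sub volume volume)).enorm
  calc ∫⁻ t, (∫⁻ s, ‖k s‖ₑ * ‖f (t - s)‖ₑ) ^ q
      ≤ ∫⁻ t, M ^ (q - 1) * ∫⁻ s, ‖k s‖ₑ * ‖f (t - s)‖ₑ ^ q := lintegral_mono hpt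
    _ = M ^ (q - 1) * ∫⁻ t, ∫⁻ s, ‖k s‖ₑ * ‖f (t - s)‖ₑ ^ q :=
        lintegral_const_mul'' _ hmeas.lintegral_prod_right'
    _ = M ^ (q - 1) * ∫⁻ s, ∫⁻ t, ‖k s‖ₑ * ‖f (t - s)‖ₑ ^ q := by
        rw [lintegral_lintegral_swap hmeas]
    _ = M ^ (q - 1) * (M * ∫⁻ t, ‖f t‖ₑ ^ q) := by
        have h : ∀ s : ℝ, ∫⁻ t, ‖k s‖ₑ * ‖f (t - s)‖ₑ ^ q = ‖k s‖ₑ * ∫⁻ t, ‖f t‖ₑ ^ q := by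
          intro s
          rw [lintegral_const_mul' _ _ enorm_ne_top,
            lintegral_sub_right_eq_self (fun t => ‖f t‖ₑ ^ q) s]
        simp_rw [h]
        rw [lintegral_mul_const'' _ hk.enorm]
    _ = M ^ q * ∫⁻ t, ‖f t‖ₑ ^ q := by
        rw [← mul_assoc]
        congr 1
        nth_rewrite 2 [← ENNReal.rpow_one M]
        rw [← ENNReal.rpow_add_of_nonneg _ _ (by linarith) zero_le_one]
        congr 1; ring

theorem conv_lintegral_bound {p : ℝ≥0∞} (hp : 1 ≤ p) {k f : ℝ → ℂ} (hk : Integrable k)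
    (hf : MemLp f p) :
    (∀ᵐ t : ℝ, ∫⁻ s, ‖k s‖ₑ * ‖f (t - s)‖ₑ < ∞) ∧
      eLpNorm (fun t : ℝ => ∫⁻ s, ‖k s‖ₑ * ‖f (t - s)‖ₑ) p volume ≤
        (∫⁻ s, ‖k s‖ₑ) * eLpNorm f p volume := by
  have hM : ∫⁻ s, ‖k s‖ₑ ≠ ∞ := hk.2.ne
  rcases eq_or_ne p ∞ with rfl | hp'
  · have hle : ∀ t : ℝ, ∫⁻ s, ‖k s‖ₑ * ‖f (t - s)‖ₑ ≤ (∫⁻ s, ‖k s‖ₑ) * eLpNorm f ∞ volume := by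
      intro t
      rw [← lintegral_mul_const'' _ hk.1.enorm]
      refine lintegral_mono_ae ?_
      have h := (quasiMeasurePreserving_sub_left (volume : Measure ℝ) t).ae
        (ae_le_eLpNormEssSup (f := f) (μ := volume))
      filter_upwards [h] with s hs
      rw [eLpNorm_exponent_top]
      gcongr
    refine ⟨.of_forall fun t => (hle t).trans_lt (ENNReal.mul_lt_top hM.lt_top hf.2), ?_⟩
    rw [eLpNorm_exponent_top (f := fun t : ℝ => ∫⁻ s, ‖k s‖ₑ * ‖f (t - s)‖ₑ)]
    exact eLpNormEssSup_le_of_ae_enorm_bound (.of_forall fun t => by simpa using hle t)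
  · have hp0 : p ≠ 0 := (zero_lt_one.trans_le hp).ne'
    have hq : 1 ≤ p.toReal := by
      simpa using ENNReal.toReal_mono hp' hp
    have hq0 : 0 < p.toReal := by linarith
    have hmain := lintegral_conv_rpow_le hq hk.1 hf.1
    have hmeas : AEMeasurable (fun z : ℝ × ℝ => ‖k z.2‖ₑ * ‖f (z.1 - z.2)‖ₑ)
        ((volume : Measure ℝ).prod volume) := by
      have h1 : AEMeasurable (fun z : ℝ × ℝ => ‖k z.2‖ₑ) ((volume : Measure ℝ).prod volume) :=
        hk.1.comp_snd.enorm
      have h2 : AEMeasurable (fun z : ℝ × ℝ => ‖f (z.1 - z.2)‖ₑ)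
          ((volume : Measure ℝ).prod volume) :=
        (hf.1.comp_quasiMeasurePreserving (quasiMeasurePreserving_sub volume volume)).enorm
      exact h1.mul h2
    have hH : AEMeasurable (fun t : ℝ => ∫⁻ s, ‖k s‖ₑ * ‖f (t - s)‖ₑ) volume :=
      AEMeasurable.lintegral_prod_right' (μ := volume) (ν := volume) hmeas
    have hfin : (∫⁻ s, ‖k s‖ₑ) ^ p.toReal * ∫⁻ t, ‖f t‖ₑ ^ p.toReal < ∞ :=
      ENNReal.mul_lt_top (ENNReal.rpow_lt_top_of_nonneg hq0.le hM)
        (lintegral_rpow_enorm_lt_top_of_eLpNorm_lt_top hp0 hp' hf.2)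
    constructor
    · filter_upwards [ae_lt_top' (hH.pow_const _) (hmain.trans_lt hfin).ne] with t ht
      exact (ENNReal.rpow_lt_top_iff_of_pos hq0).1 ht
    · rw [eLpNorm_eq_lintegral_rpow_enorm_toReal hp0 hp',
        eLpNorm_eq_lintegral_rpow_enorm_toReal hp0 hp']
      have h2 := ENNReal.rpow_le_rpow hmain (z := 1 / p.toReal) (by positivity)
      rw [ENNReal.mul_rpow_of_nonneg _ _ (by positivity), ← ENNReal.rpow_mul,
        mul_one_div_cancel hq0.ne', ENNReal.rpow_one] at h2
      simpa using h2

theorem conv_ae_exists {p : ℝ≥0∞} (hp : 1 ≤ p) {k f : ℝ → ℂ} (hk : Integrable k)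
    (hf : MemLp f p) :
    ∀ᵐ t : ℝ, ConvolutionExistsAt k f t (ContinuousLinearMap.mul ℂ ℂ) volume := by
  filter_upwards [(conv_lintegral_bound hp hk hf).1] with t ht
  refine ⟨hk.1.convolution_integrand_snd _ hf.1 t, ?_⟩
  simpa [HasFiniteIntegral, enorm_mul] using ht

theorem eLpNorm_conv_le {p : ℝ≥0∞} (hp : 1 ≤ p) {k f : ℝ → ℂ} (hk : Integrable k)
    (hf : MemLp f p) :
    eLpNorm (convolution k f (ContinuousLinearMap.mul ℂ ℂ) volume) p volume ≤
      eLpNorm k 1 volume * eLpNorm f p volume := by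
  rw [eLpNorm_one_eq_lintegral_enorm]
  refine le_trans (eLpNorm_mono_enorm fun t => ?_) (conv_lintegral_bound hp hk hf).2
  rw [convolution_def, enorm_eq_self]
  refine (enorm_integral_le_lintegral_enorm _).trans (le_of_eq ?_)
  simp [enorm_mul]

theorem memLp_conv {p : ℝ≥0∞} (hp : 1 ≤ p) {k f : ℝ → ℂ} (hk : Integrable k)
    (hf : MemLp f p) :
    MemLp (convolution k f (ContinuousLinearMap.mul ℂ ℂ) volume) p volume := by
  refine ⟨?_, (eLpNorm_conv_le hp hk hf).trans_lt (ENNReal.mul_lt_top ?_ hf.2)⟩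
  · exact (hk.1.convolution_integrand _ hf.1).integral_prod_right'
  · exact (memLp_one_iff_integrable.2 hk).2

/-! ### The algebra `G` -/

/-- An element `a(t) = ∑_δ a_δ e^{iδt} + ∫ k(s) e^{its} ds` of the algebra `G`, given by its
absolutely summable family of coefficients `a_δ` (`δ ∈ ℝ`; at most countably many are nonzero) and
its integrable kernel `k`. The function `a` determines the coefficients, and the kernel up to
equality almost everywhere. -/
structure G where
  /-- the coefficient of `e^{iδt}` -/
  coeff : ℝ → ℂ
  /-- the kernel of the Fourier integral -/
  kern : ℝ → ℂ
  summable_coeff : Summable fun δ => ‖coeff δ‖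
  integrable_kern : Integrable kern

namespace G

/-- The almost periodic part `∑_δ a_δ e^{iδt}`. -/
def apPart (a : G) (t : ℝ) : ℂ :=
  ∑' δ : ℝ, a.coeff δ * Complex.exp (Complex.I * δ * t)

/-- The part `∫ k(s) e^{its} ds` in the algebra of Fourier transforms of integrable functions. -/
def fourierPart (a : G) (t : ℝ) : ℂ :=
  ∫ s : ℝ, a.kern s * Complex.exp (Complex.I * t * s)

/-- The function `ℝ → ℂ` represented by `a`. -/
def toFun (a : G) (t : ℝ) : ℂ := a.apPart t + a.fourierPart t

instance : CoeFun G fun _ => ℝ → ℂ := ⟨toFun⟩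

/-- The subalgebra `G⁺`: all frequencies are nonnegative and the kernel vanishes on the negative
semi-axis. -/
def IsPlus (a : G) : Prop :=
  (∀ δ < 0, a.coeff δ = 0) ∧ ∀ᵐ s : ℝ, s < 0 → a.kern s = 0

/-- The subalgebra `G⁻`: all frequencies are nonpositive and the kernel vanishes on the positive
semi-axis. -/
def IsMinus (a : G) : Prop :=
  (∀ δ > 0, a.coeff δ = 0) ∧ ∀ᵐ s : ℝ, 0 < s → a.kern s = 0

end G

/-- `θ` is a continuous branch of the argument of `f` (used for nowhere vanishing `f`, for which `θ`
is unique up to a constant in `2πℤ`). -/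
def IsArg (f : ℝ → ℂ) (θ : ℝ → ℝ) : Prop :=
  Continuous θ ∧ ∀ t, f t = ‖f t‖ * Complex.exp (Complex.I * θ t)

/-- `ν(a) = ν`, where `ν(a) = lim_{l → ∞} (1/2l) [arg b(t)]_{-l}^{l}` and `b` is the almost periodic
part of `a`. -/
def HasNu (a : G) (ν : ℝ) : Prop :=
  ∃ θ : ℝ → ℝ, IsArg a.apPart θ ∧
    Filter.Tendsto (fun l : ℝ => (θ l - θ (-l)) / (2 * l)) Filter.atTop (nhds ν)

/-- `n(a) = n`, where `n(a) = (1/2π) [arg (1 + b(t)⁻¹ k(t))]_{t = -∞}^{∞}` and `b`, `k` are the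
almost periodic part and the Fourier integral part of `a`. -/
def HasWinding (a : G) (n : ℤ) : Prop :=
  ∃ (θ : ℝ → ℝ) (θ₁ θ₂ : ℝ),
    IsArg (fun t => 1 + (a.apPart t)⁻¹ * a.fourierPart t) θ ∧
    Filter.Tendsto θ Filter.atBot (nhds θ₁) ∧ Filter.Tendsto θ Filter.atTop (nhds θ₂) ∧
    (n : ℝ) = (θ₂ - θ₁) / (2 * Real.pi)

/-- The function `χ(t) = (t - i) / (t + i)`. -/
def chi (t : ℝ) : ℂ := (t - Complex.I) / (t + Complex.I)

/-- The factorization `g(t) = g₋(t) e^{iνt} χ(t)ⁿ g₊(t)` with `g₊, g₊⁻¹ ∈ G⁺` and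
`g₋, g₋⁻¹ ∈ G⁻`; here `gmInv` and `gpInv` stand for `g₋⁻¹` and `g₊⁻¹`. -/
structure IsFactorization (g : G) (ν : ℝ) (n : ℤ) (gm gmInv gp gpInv : G) : Prop where
  minus : gm.IsMinus
  minus_inv : gmInv.IsMinus
  minus_mul_inv : ∀ t : ℝ, gm t * gmInv t = 1
  plus : gp.IsPlus
  plus_inv : gpInv.IsPlus
  plus_mul_inv : ∀ t : ℝ, gp t * gpInv t = 1
  eq : ∀ t : ℝ, g t = gm t * Complex.exp (Complex.I * ν * t) * chi t ^ n * gp t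

/-- `ξ(g) = (-1)ⁿ g(0)`, where `n = n(g)`. -/
def xi (g : G) (n : ℤ) : ℂ := (-1) ^ n * g 0

/-! ### Operators on `L^p(ℝ)` -/

/-- The complex space `L^p(ℝ)`. -/
abbrev LpR (p : ℝ≥0∞) : Type := Lp ℂ p (volume : Measure ℝ)

variable (p : ℝ≥0∞) [Fact (1 ≤ p)]

/-- The translation `(τ_v f)(t) = f(t - v)`. -/
def translation (v : ℝ) : LpR p →L[ℂ] LpR p :=
  (Lp.compMeasurePreservingₗᵢ ℂ (fun t : ℝ => t - v)
    (measurePreserving_sub_right volume v)).toContinuousLinearMap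

/-- The reflection `(J f)(t) = f(-t)`. -/
def reflect : LpR p →L[ℂ] LpR p :=
  (Lp.compMeasurePreservingₗᵢ ℂ (Neg.neg : ℝ → ℝ)
    (Measure.measurePreserving_neg volume)).toContinuousLinearMap

/-- The convolution operator `(C_k f)(t) = ∫ k(s) f(t - s) ds = ∫ k(t - s) f(s) ds` with an
integrable kernel. -/
def convOp (k : ℝ → ℂ) (hk : Integrable k) : LpR p →L[ℂ] LpR p :=
  LinearMap.mkContinuous
    { toFun := fun f => (memLp_conv (Fact.out : 1 ≤ p) hk (Lp.memLp f)).toLp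
        (convolution k f (ContinuousLinearMap.mul ℂ ℂ) volume)
      map_add' := fun f g => by
        rw [← MemLp.toLp_add, MemLp.toLp_eq_toLp_iff,
          convolution_congr _ (Filter.EventuallyEq.refl _ k) (Lp.coeFn_add f g)]
        filter_upwards [conv_ae_exists (Fact.out : 1 ≤ p) hk (Lp.memLp f),
          conv_ae_exists (Fact.out : 1 ≤ p) hk (Lp.memLp g)] with t hf hg
        exact hf.distrib_add hg
      map_smul' := fun c f => by
        rw [RingHom.id_apply, ← MemLp.toLp_const_smul, MemLp.toLp_eq_toLp_iff,
          convolution_congr _ (Filter.EventuallyEq.refl _ k) (Lp.coeFn_smul c f),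
          convolution_smul] }
    (eLpNorm k 1 volume).toReal
    (fun f => by
      change ‖(memLp_conv (Fact.out : 1 ≤ p) hk (Lp.memLp f)).toLp _‖ ≤ _
      rw [Lp.norm_toLp, Lp.norm_def, ← ENNReal.toReal_mul]
      exact ENNReal.toReal_mono
        (ENNReal.mul_ne_top (memLp_one_iff_integrable.2 hk).2.ne (Lp.memLp f).2.ne)
        (eLpNorm_conv_le (Fact.out : 1 ≤ p) hk (Lp.memLp f)))

/-- Multiplication by the indicator function of a measurable set. -/
def indicatorOp (s : Set ℝ) (hs : MeasurableSet s) : LpR p →L[ℂ] LpR p :=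
  LinearMap.mkContinuous
    { toFun := fun f => ((Lp.memLp f).indicator hs).toLp (s.indicator f)
      map_add' := fun f g => by
        rw [← MemLp.toLp_add, MemLp.toLp_eq_toLp_iff, ← Set.indicator_add']
        filter_upwards [Lp.coeFn_add f g] with t ht
        by_cases h : t ∈ s
        · rw [Set.indicator_of_mem h, Set.indicator_of_mem h, ht]
        · rw [Set.indicator_of_notMem h, Set.indicator_of_notMem h]
      map_smul' := fun c f => by
        rw [RingHom.id_apply, ← MemLp.toLp_const_smul, MemLp.toLp_eq_toLp_iff]
        filter_upwards [Lp.coeFn_smul c f] with t ht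
        rw [Pi.smul_apply]
        by_cases h : t ∈ s
        · rw [Set.indicator_of_mem h, Set.indicator_of_mem h, ht, Pi.smul_apply]
        · rw [Set.indicator_of_notMem h, Set.indicator_of_notMem h, smul_zero] }
    1
    (fun f => by
      change ‖((Lp.memLp f).indicator hs).toLp _‖ ≤ _
      rw [Lp.norm_toLp, Lp.norm_def, one_mul]
      exact ENNReal.toReal_mono (Lp.memLp f).2.ne (eLpNorm_indicator_le _))

theorem coeFn_indicatorOp (s : Set ℝ) (hs : MeasurableSet s) (f : LpR p) :
    indicatorOp p s hs f =ᵐ[volume] s.indicator f := by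
  have h : indicatorOp p s hs f = ((Lp.memLp f).indicator hs).toLp (s.indicator f) := rfl
  rw [h]
  exact MemLp.coeFn_toLp _

/-- The projection `P` of `L^p(ℝ)` onto `L^p(ℝ⁺)`. -/
def projP : LpR p →L[ℂ] LpR p := indicatorOp p (Set.Ioi 0) measurableSet_Ioi

/-- The projection `Q` of `L^p(ℝ)` onto `L^p(ℝ⁻)`. -/
def projQ : LpR p →L[ℂ] LpR p := indicatorOp p (Set.Iio 0) measurableSet_Iio

/-- The operator `(W⁰(a) f)(t) = ∑_δ a_δ f(t - δ) + ∫ k(t - s) f(s) ds` on `L^p(ℝ)`. The sum of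
translations is absolutely convergent in the operator norm. -/
def W0 (a : G) : LpR p →L[ℂ] LpR p :=
  (∑' δ : ℝ, a.coeff δ • translation p δ) + convOp p a.kern a.integrable_kern

theorem summable_translation (a : G) : Summable fun δ : ℝ => a.coeff δ • translation p δ := by
  refine Summable.of_norm_bounded a.summable_coeff fun δ => ?_
  rw [norm_smul]
  exact mul_le_of_le_one_right (norm_nonneg _) (LinearIsometry.norm_toContinuousLinearMap_le _)

/-! ### Operators on `L^p(ℝ⁺)` -/

/-- The space `L^p(ℝ⁺)`, identified with the subspace of `L^p(ℝ)` consisting of all functions that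
vanish on the negative semi-axis. -/
def LpPlus : Submodule ℂ (LpR p) where
  carrier := {f | ∀ᵐ t : ℝ, t < 0 → f t = 0}
  add_mem' := fun {f g} hf hg => by
    filter_upwards [hf, hg, Lp.coeFn_add f g] with t h1 h2 h3 ht
    rw [h3, Pi.add_apply, h1 ht, h2 ht, add_zero]
  zero_mem' := by
    filter_upwards [Lp.coeFn_zero ℂ p (volume : Measure ℝ)] with t h1 _
    rw [h1, Pi.zero_apply]
  smul_mem' := fun c f hf => by
    filter_upwards [hf, Lp.coeFn_smul c f] with t h1 h2 ht
    rw [h2, Pi.smul_apply, h1 ht, smul_zero]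

theorem projP_mem (f : LpR p) : projP p f ∈ LpPlus p := by
  change ∀ᵐ t : ℝ, t < 0 → _
  have h : projP p f =ᵐ[volume] (Set.Ioi (0 : ℝ)).indicator f := coeFn_indicatorOp p _ _ f
  filter_upwards [h] with t ht hneg
  rw [ht, Set.indicator_of_notMem (by simpa using hneg.le)]

theorem reflect_projQ_mem (f : LpR p) : reflect p (projQ p f) ∈ LpPlus p := by
  change ∀ᵐ t : ℝ, t < 0 → _
  have h : projQ p f =ᵐ[volume] (Set.Iio (0 : ℝ)).indicator f := coeFn_indicatorOp p _ _ f
  have h1 : reflect p (projQ p f) =ᵐ[volume] projQ p f ∘ (Neg.neg : ℝ → ℝ) :=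
    Lp.coeFn_compMeasurePreserving _ _
  have h2 := (Measure.measurePreserving_neg (volume : Measure ℝ)).quasiMeasurePreserving.ae h
  filter_upwards [h1, h2] with t ht ht2 hneg
  rw [ht, Function.comp_apply, ht2, Set.indicator_of_notMem (by simpa using hneg.le)]

/-- The operator `W(a) f = P W⁰(a) f` on `L^p(ℝ⁺)`. -/
def W (a : G) : LpPlus p →L[ℂ] LpPlus p :=
  (projP p ∘L W0 p a ∘L (LpPlus p).subtypeL).codRestrict (LpPlus p) fun _ => projP_mem p _

/-- The operator `J Q W⁰(g) P` on `L^p(ℝ⁺)`. -/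
def JQWP (g : G) : LpPlus p →L[ℂ] LpPlus p :=
  (reflect p ∘L projQ p ∘L W0 p g ∘L projP p ∘L (LpPlus p).subtypeL).codRestrict (LpPlus p)
    fun _ => reflect_projQ_mem p _

/-- The null space of `W(g)`. -/
def kerW (g : G) : Submodule ℂ (LpPlus p) := LinearMap.ker (W p g : LpPlus p →ₗ[ℂ] LpPlus p)

/-- The operator `𝐏(g)`, the restriction of `J Q W⁰(g) P` to `ker W(g)`. -/
def boldP (g : G) : kerW p g →ₗ[ℂ] LpPlus p :=
  (JQWP p g : LpPlus p →ₗ[ℂ] LpPlus p) ∘ₗ (kerW p g).subtype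

/-- The operator `𝐏⁺(g) = (1/2)(I + 𝐏(g))` on `ker W(g)`. -/
def boldPPlus (g : G) : kerW p g →ₗ[ℂ] LpPlus p :=
  (1 / 2 : ℂ) • ((kerW p g).subtype + boldP p g)

/-- The operator `𝐏⁻(g) = (1/2)(I - 𝐏(g))` on `ker W(g)`. -/
def boldPMinus (g : G) : kerW p g →ₗ[ℂ] LpPlus p :=
  (1 / 2 : ℂ) • ((kerW p g).subtype - boldP p g)

theorem memLp_expDecay : MemLp
    ((Set.Ioi (0 : ℝ)).indicator fun t : ℝ => Complex.exp (-(t : ℂ))) p volume := by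
  set f : ℝ → ℂ := (Set.Ioi (0 : ℝ)).indicator fun t : ℝ => Complex.exp (-(t : ℂ)) with hf
  have hm : Measurable f := Measurable.indicator (by fun_prop) measurableSet_Ioi
  have hb : ∀ t, ‖f t‖ ≤ 1 := by
    intro t
    by_cases h : t ∈ Set.Ioi (0 : ℝ)
    · rw [hf, Set.indicator_of_mem h, Complex.norm_exp]
      simpa using le_of_lt h
    · rw [hf, Set.indicator_of_notMem h]; simp
  rcases eq_or_ne p ∞ with rfl | hp'
  · exact memLp_top_of_bound hm.aestronglyMeasurable 1 (.of_forall hb)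
  have hp1 : 1 ≤ p := Fact.out
  have hp0 : p ≠ 0 := (zero_lt_one.trans_le hp1).ne'
  have hq : 1 ≤ p.toReal := by simpa using ENNReal.toReal_mono hp' hp1
  refine ⟨hm.aestronglyMeasurable, ?_⟩
  have hint : Integrable f := by
    rw [hf, integrable_indicator_iff measurableSet_Ioi]
    refine (integrable_norm_iff (by fun_prop)).1 ?_
    simpa [Complex.norm_exp, IntegrableOn] using integrableOn_exp_neg_Ioi 0
  rw [eLpNorm_lt_top_iff_lintegral_rpow_enorm_lt_top hp0 hp']
  refine lt_of_le_of_lt (lintegral_mono fun t => ?_) hint.2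
  have h1 : ‖f t‖ₑ ≤ 1 := by
    have := hb t
    rw [← ofReal_norm]
    exact ENNReal.ofReal_le_one.2 this
  simpa using ENNReal.rpow_le_rpow_of_exponent_ge h1 hq

/-- The function `ψ₀(t) = e^{-t}`, `t > 0`, as an element of `L^p(ℝ⁺)`. -/
def psi0 : LpPlus p :=
  ⟨(memLp_expDecay p).toLp _, by
    change ∀ᵐ t : ℝ, t < 0 → _
    filter_upwards [MemLp.coeFn_toLp (memLp_expDecay p)] with t ht hneg
    rw [ht, Set.indicator_of_notMem (by simpa using hneg.le)]⟩

end

end WienerHopf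

open WienerHopf

/-!
# The kernel of a Wiener-Hopf operator whose symbol satisfies `g g̃ = 1`

The functions of `G` are the Fourier transforms `ev t x` of the elements `x` of the commutative
Banach algebra `Alg = ℓ¹(ℝ) ⊕ L¹(ℝ)` of measures without singular continuous part. The Fourier
transform is injective (`coef_eq_zero_and_kernel_ae_eq_zero`), so that all identities in `Alg` can
be checked pointwise, and `Alg.op` represents `Alg` by the operators `W⁰` on `L^p(ℝ)`.

*The factorization.* It suffices to write `g = χ⁻¹ e^c` with `χ(t) = (t - i)/(t + i)` and `c ∈ Alg`:
`c` is the sum of an element carried by `[0, ∞)` and one carried by `(-∞, 0]`, the exponentials of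
which are the factors (`exists_isFactorization`). The almost periodic part of `g` and its quotient
`1 + k̂` are treated separately. In both cases the invertible element is approximated by simpler
ones, and elements near `1` are exponentials (`Alg.eventually_exists_exp`), so that a logarithm has
to be found for the simpler ones only.
* The almost periodic part (`Alg.exists_eq_smul_delta_mul_exp`) is approximated by a trigonometric
  polynomial `p`. Let `φ_j` be additive functionals on `ℝ` that separate points and take integer
  values at the frequencies of `p` and of an approximate inverse, only finitely many of them being
  nonzero there. Multiplication of the `δ`-th coefficient by `φ_j(δ)` is a derivation `D_j`. The
  logarithmic derivatives `d_j = D_j p / p` satisfy `φ_i(δ) d_j(δ) = φ_j(δ) d_i(δ)`, hence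
  `c(δ) = ∑ φ_j(δ) d_j(δ) / ∑ φ_j(δ)²` is a common primitive of them away from `δ = 0`. Then
  `e^{-c} p` is an eigenvector of every `D_j`, and so a single exponential `C e^{iδ₀t}`. The mean
  motion `ν` is `δ₀`.
* In `1 + k̂` (`Alg.exists_eq_chi_zpow_mul_exp_evKern`), `k` is approximated by a Schwartz
  function. Then the logarithmic derivative has a Lipschitz continuous kernel `d`, and
  `(d(s) - d(0) e^{-|s|}) / s` is the kernel of a logarithm, up to a multiple of `arctan t`;
  comparison of the limits at `±∞` turns that multiple into a power of `χ`. Its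
  exponent is the winding number.

*The kernel.* Let `g = g₋ χ⁻¹ g₊` (`kernel_of_factorization`). Since `W⁰` is multiplicative and the
one-sided factors preserve the two half-lines, `f ∈ ker W(g)` if and only if
`W⁰(χ⁻¹) W⁰(g₊) f` is carried by `(-∞, 0)`. Since `χ` has the kernel `-2 e^{-s}` on `s > 0`, this
forces `W⁰(g₊) f` to be a multiple of `ψ₀`, and `W⁰(χ⁻¹) ψ₀ = -J ψ₀`. Finally `g g̃ = 1` gives
`g₊ g̃₋ = (g₋ g̃₊)⁻¹`, which belongs to both one-sided subalgebras and is therefore constant; its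
value at `0` is `ξ(g)`. So `J W⁰(g)` acts on the kernel as `-ξ(g)`.
-/

namespace WienerHopf

noncomputable section

open Filter Topology

/-! ### Absolutely summable families indexed by `ℝ` -/

/-- The space `ℓ¹(ℝ)` of absolutely summable families of complex numbers indexed by the discrete
set of real numbers. -/
abbrev Coef : Type := lp (fun _ : ℝ => ℂ) 1

namespace Coef

/-- The family with value `1` at `δ` and `0` elsewhere. -/
def delta (δ : ℝ) : Coef := lp.single 1 δ (1 : ℂ)

theorem delta_apply (δ ε : ℝ) : delta δ ε = if ε = δ then 1 else 0 := by
  unfold delta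
  rw [lp.single_apply]
  by_cases h : ε = δ
  · subst h; simp
  · simp [h]

theorem norm_delta (δ : ℝ) : ‖delta δ‖ = 1 := by
  rw [delta, lp.norm_single (by norm_num)]; simp

theorem summable_norm (a : Coef) : Summable fun δ => ‖a δ‖ := by
  simpa using (memℓp_gen_iff (p := 1) (by simp)).1 (lp.memℓp a)

theorem norm_eq (a : Coef) : ‖a‖ = ∑' δ, ‖a δ‖ := by
  simpa using lp.norm_eq_tsum_rpow (p := 1) (by simp) a

/-- The absolutely summable family underlying a summable function. -/
def of (a : ℝ → ℂ) (ha : Summable fun δ => ‖a δ‖) : Coef :=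
  ⟨a, (memℓp_gen_iff (p := 1) (by simp)).2 (by simpa using ha)⟩

@[simp] theorem of_apply (a : ℝ → ℂ) (ha : Summable fun δ => ‖a δ‖) (δ : ℝ) : of a ha δ = a δ := rfl

theorem hasSum_delta (a : Coef) : HasSum (fun δ => a δ • delta δ) a := by
  have h := lp.hasSum_single (E := fun _ : ℝ => ℂ) (p := 1) (by simp) a
  convert! h using 2 with δ
  rw [delta, ← lp.single_smul]; simp

/-- Two continuous linear maps on `ℓ¹(ℝ)` that agree on the unit families are equal. -/
theorem hom_ext {E : Type*} [NormedAddCommGroup E] [NormedSpace ℂ E] {S T : Coef →L[ℂ] E}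
    (h : ∀ δ, S (delta δ) = T (delta δ)) : S = T := by
  ext1 a
  have hS := S.hasSum (hasSum_delta a)
  have hT := T.hasSum (hasSum_delta a)
  simp only [map_smul, h] at hS hT
  exact hS.unique hT

section sumL

theorem summable_norm_smul {E : Type*} [NormedAddCommGroup E] [NormedSpace ℂ E] (v : ℝ → E)
    (hv : ∀ δ, ‖v δ‖ ≤ 1) (a : Coef) :
    Summable fun δ => ‖a δ • v δ‖ := by
  refine Summable.of_nonneg_of_le (fun _ => norm_nonneg _) (fun δ => ?_) (summable_norm a)
  rw [norm_smul]
  exact mul_le_of_le_one_right (norm_nonneg _) (hv δ)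

variable {E : Type*} [NormedAddCommGroup E] [NormedSpace ℂ E] [CompleteSpace E]

/-- The operator `a ↦ ∑_δ a_δ v_δ` given by vectors `v_δ` of norm at most `1`. -/
def sumL (v : ℝ → E) (hv : ∀ δ, ‖v δ‖ ≤ 1) : Coef →L[ℂ] E :=
  LinearMap.mkContinuous
    { toFun := fun a => ∑' δ, a δ • v δ
      map_add' := fun a b => by
        rw [← (summable_norm_smul v hv a).of_norm.tsum_add (summable_norm_smul v hv b).of_norm]
        simp [add_smul]
      map_smul' := fun c a => by
        rw [RingHom.id_apply, ← (summable_norm_smul v hv a).of_norm.tsum_const_smul]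
        simp [mul_smul] }
    1
    (fun a => by
      change ‖∑' δ, a δ • v δ‖ ≤ _
      rw [one_mul, norm_eq]
      refine (norm_tsum_le_tsum_norm (summable_norm_smul v hv a)).trans ?_
      refine (summable_norm_smul v hv a).tsum_le_tsum (fun δ => ?_) (summable_norm a)
      rw [norm_smul]
      exact mul_le_of_le_one_right (norm_nonneg _) (hv δ))

theorem sumL_apply (v : ℝ → E) (hv : ∀ δ, ‖v δ‖ ≤ 1) (a : Coef) :
    sumL v hv a = ∑' δ, a δ • v δ := rfl

theorem norm_sumL_le (v : ℝ → E) (hv : ∀ δ, ‖v δ‖ ≤ 1) : ‖sumL v hv‖ ≤ 1 :=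
  LinearMap.mkContinuous_norm_le _ zero_le_one _

theorem norm_sumL_apply_le (v : ℝ → E) (hv : ∀ δ, ‖v δ‖ ≤ 1) (a : Coef) :
    ‖sumL v hv a‖ ≤ ‖a‖ :=
  ((sumL v hv).le_of_opNorm_le (norm_sumL_le v hv) a).trans (one_mul _).le

@[simp] theorem sumL_delta (v : ℝ → E) (hv : ∀ δ, ‖v δ‖ ≤ 1) (δ : ℝ) :
    sumL v hv (delta δ) = v δ := by
  rw [sumL_apply, tsum_eq_single δ]
  · simp [delta_apply]
  · intro ε hε; simp [delta_apply, hε]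

end sumL

/-- Translation by `δ` on `ℓ¹(ℝ)`. -/
def shift (δ : ℝ) : Coef →L[ℂ] Coef := sumL (fun ε => delta (δ + ε)) fun _ => (norm_delta _).le

theorem norm_shift_le (δ : ℝ) : ‖shift δ‖ ≤ 1 := norm_sumL_le _ _

/-- Convolution on `ℓ¹(ℝ)`, the bilinear extension of `δ_x * δ_y = δ_{x + y}`. -/
def conv : Coef →L[ℂ] Coef →L[ℂ] Coef := sumL shift norm_shift_le

theorem conv_delta_delta (δ ε : ℝ) : conv (delta δ) (delta ε) = delta (δ + ε) := by
  simp [conv, shift]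

theorem norm_conv_le (a b : Coef) : ‖conv a b‖ ≤ ‖a‖ * ‖b‖ :=
  (conv a).le_of_opNorm_le (norm_sumL_apply_le _ _ a) b

/-- Evaluation of a family at a real number. -/
def evalL (γ : ℝ) : Coef →L[ℂ] ℂ := lp.evalCLM ℂ (fun _ : ℝ => ℂ) 1 γ

@[simp] theorem evalL_apply (γ : ℝ) (a : Coef) : evalL γ a = a γ := rfl

theorem shift_apply (δ γ : ℝ) (a : Coef) : shift δ a γ = a (γ - δ) := by
  have : (evalL γ) ∘L (shift δ) = evalL (γ - δ) := by
    refine hom_ext fun ε => ?_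
    simp only [ContinuousLinearMap.comp_apply, shift, sumL_delta, evalL_apply, delta_apply]
    congr 1
    rw [eq_iff_iff, sub_eq_iff_eq_add']
  exact DFunLike.congr_fun this a

theorem hasSum_conv (a b : Coef) (γ : ℝ) :
    HasSum (fun δ => a δ * b (γ - δ)) (conv a b γ) := by
  have h := (summable_norm_smul shift norm_shift_le a).of_norm.hasSum
  have h2 := ((evalL γ) ∘L (ContinuousLinearMap.apply ℂ Coef b)).hasSum h
  simpa [shift_apply, conv, sumL_apply] using h2

end Coef

end

noncomputable section

open Filter Topology

/-! ### Operators on `L^p(ℝ)` with coefficients in `ℓ¹(ℝ)` and kernels in `L¹(ℝ)` -/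

variable (p : ℝ≥0∞) [Fact (1 ≤ p)]

theorem coeFn_translation (v : ℝ) (f : LpR p) :
    translation p v f =ᵐ[volume] fun t => f (t - v) :=
  Lp.coeFn_compMeasurePreserving _ _

theorem coeFn_reflect (f : LpR p) : reflect p f =ᵐ[volume] fun t => f (-t) :=
  Lp.coeFn_compMeasurePreserving _ _

theorem coeFn_convOp (k : ℝ → ℂ) (hk : Integrable k) (f : LpR p) :
    convOp p k hk f =ᵐ[volume] convolution k f (ContinuousLinearMap.mul ℂ ℂ) volume :=
  MemLp.coeFn_toLp (memLp_conv (Fact.out : 1 ≤ p) hk (Lp.memLp f))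

theorem ae_comp_sub {P : ℝ → Prop} (h : ∀ᵐ t : ℝ, P t) (v : ℝ) : ∀ᵐ t : ℝ, P (t - v) :=
  (measurePreserving_sub_right (volume : Measure ℝ) v).quasiMeasurePreserving.ae h

theorem ae_comp_neg {P : ℝ → Prop} (h : ∀ᵐ t : ℝ, P t) : ∀ᵐ t : ℝ, P (-t) :=
  (Measure.measurePreserving_neg (volume : Measure ℝ)).quasiMeasurePreserving.ae h

theorem norm_translation_le (v : ℝ) : ‖translation p v‖ ≤ 1 :=
  LinearIsometry.norm_toContinuousLinearMap_le _

theorem translation_comp (v w : ℝ) :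
    translation p v ∘L translation p w = translation p (v + w) := by
  ext1 f
  refine Lp.ext ?_
  filter_upwards [coeFn_translation p v (translation p w f),
    ae_comp_sub (coeFn_translation p w f) v, coeFn_translation p (v + w) f] with t h1 h2 h3
  rw [ContinuousLinearMap.comp_apply, h1, h2, h3, sub_sub]

/-- The operator `∑_δ a_δ τ_δ` on `L^p(ℝ)`, as a function of the family `a`. -/
def apOp : Coef →L[ℂ] LpR p →L[ℂ] LpR p := Coef.sumL (translation p) (norm_translation_le p)

theorem apOp_delta (δ : ℝ) : apOp p (Coef.delta δ) = translation p δ := Coef.sumL_delta _ _ _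

theorem norm_apOp_le (a : Coef) (f : LpR p) : ‖apOp p a f‖ ≤ ‖a‖ * ‖f‖ :=
  (apOp p a).le_of_opNorm_le (Coef.norm_sumL_apply_le _ _ a) f

theorem apOp_conv (a b : Coef) : apOp p (Coef.conv a b) = apOp p a ∘L apOp p b := by
  let C := ContinuousLinearMap.compL ℂ (LpR p) (LpR p) (LpR p)
  have h : (ContinuousLinearMap.compL ℂ Coef Coef _ (apOp p)) ∘L Coef.conv
      = (C.flip ∘L apOp p).flip ∘L apOp p := by
    refine Coef.hom_ext fun δ => Coef.hom_ext fun ε => ?_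
    change apOp p (Coef.conv (Coef.delta δ) (Coef.delta ε)) =
      apOp p (Coef.delta δ) ∘L apOp p (Coef.delta ε)
    rw [Coef.conv_delta_delta, apOp_delta, apOp_delta, apOp_delta, translation_comp]
  exact DFunLike.congr_fun (DFunLike.congr_fun h a) b

theorem integrable_L1 (k : LpR 1) : Integrable k := L1.integrable_coeFn k

theorem convOp_congr {k l : ℝ → ℂ} (hk : Integrable k) (hl : Integrable l) (h : k =ᵐ[volume] l) :
    convOp p k hk = convOp p l hl := by
  ext1 f
  refine Lp.ext ?_
  filter_upwards [coeFn_convOp p k hk f, coeFn_convOp p l hl f] with t h1 h2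
  rw [h1, h2, convolution_congr _ h (EventuallyEq.refl _ f)]

theorem norm_convOp_le (k : LpR 1) : ‖convOp p k (integrable_L1 k)‖ ≤ ‖k‖ :=
  LinearMap.mkContinuous_norm_le _ ENNReal.toReal_nonneg _

/-- Convolution `L¹(ℝ) × L^p(ℝ) → L^p(ℝ)`. -/
def convL : LpR 1 →L[ℂ] LpR p →L[ℂ] LpR p :=
  LinearMap.mkContinuous
    { toFun := fun k => convOp p k (integrable_L1 k)
      map_add' := fun k l => by
        ext1 f
        refine Lp.ext ?_
        rw [add_apply]
        filter_upwards [coeFn_convOp p _ (integrable_L1 (k + l)) f,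
          coeFn_convOp p _ (integrable_L1 k) f, coeFn_convOp p _ (integrable_L1 l) f,
          Lp.coeFn_add (convOp p k (integrable_L1 k) f) (convOp p l (integrable_L1 l) f),
          conv_ae_exists (Fact.out : 1 ≤ p) (integrable_L1 k) (Lp.memLp f),
          conv_ae_exists (Fact.out : 1 ≤ p) (integrable_L1 l) (Lp.memLp f)]
          with t h1 h2 h3 h4 h5 h6
        rw [h1, h4, Pi.add_apply, h2, h3,
          convolution_congr _ (Lp.coeFn_add k l) (EventuallyEq.refl _ f)]
        exact h5.add_distrib h6
      map_smul' := fun c k => by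
        ext1 f
        refine Lp.ext ?_
        rw [RingHom.id_apply, smul_apply]
        filter_upwards [coeFn_convOp p _ (integrable_L1 (c • k)) f,
          coeFn_convOp p _ (integrable_L1 k) f,
          Lp.coeFn_smul c (convOp p k (integrable_L1 k) f)] with t h1 h2 h3
        rw [h1, h3, Pi.smul_apply, h2,
          convolution_congr _ (Lp.coeFn_smul c k) (EventuallyEq.refl _ f), smul_convolution]
        rfl }
    1
    (fun k => by rw [one_mul]; exact norm_convOp_le p k)

theorem convL_apply (k : LpR 1) : convL p k = convOp p k (integrable_L1 k) := rfl

theorem coeFn_convL (k : LpR 1) (f : LpR p) :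
    convL p k f =ᵐ[volume] convolution k f (ContinuousLinearMap.mul ℂ ℂ) volume :=
  coeFn_convOp p _ (integrable_L1 k) f

theorem norm_convL_apply_le (k : LpR 1) (f : LpR p) : ‖convL p k f‖ ≤ ‖k‖ * ‖f‖ :=
  (convL p k).le_of_opNorm_le (norm_convOp_le p k) f

theorem convL_translation_left (δ : ℝ) (k : LpR 1) :
    convL p (translation 1 δ k) = translation p δ ∘L convL p k := by
  ext1 f
  refine Lp.ext ?_
  filter_upwards [coeFn_convL p (translation 1 δ k) f, coeFn_translation p δ (convL p k f),
    ae_comp_sub (coeFn_convL p k f) δ] with t h1 h2 h3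
  rw [ContinuousLinearMap.comp_apply, h1, h2, h3,
    convolution_congr _ (coeFn_translation 1 δ k) (EventuallyEq.refl _ f),
    convolution_def, convolution_def,
    ← integral_sub_right_eq_self (fun s => (ContinuousLinearMap.mul ℂ ℂ) (k s) (f (t - δ - s))) δ]
  congr 1 with s
  rw [show t - δ - (s - δ) = t - s by ring]

theorem convL_translation_right (δ : ℝ) (k : LpR 1) :
    convL p k ∘L translation p δ = translation p δ ∘L convL p k := by
  ext1 f
  refine Lp.ext ?_
  filter_upwards [coeFn_convL p k (translation p δ f), coeFn_translation p δ (convL p k f),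
    ae_comp_sub (coeFn_convL p k f) δ] with t h1 h2 h3
  rw [ContinuousLinearMap.comp_apply, ContinuousLinearMap.comp_apply, h1, h2, h3,
    convolution_congr _ (EventuallyEq.refl _ k) (coeFn_translation p δ f),
    convolution_def, convolution_def]
  congr 1 with s
  rw [show t - s - δ = t - δ - s by ring]

theorem convL_apOp_left (a : Coef) (k : LpR 1) :
    convL p (apOp 1 a k) = apOp p a ∘L convL p k := by
  let C := ContinuousLinearMap.compL ℂ (LpR p) (LpR p) (LpR p)
  have h : convL p ∘L (apOp 1).flip k = C.flip (convL p k) ∘L apOp p := by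
    refine Coef.hom_ext fun δ => ?_
    change convL p (apOp 1 (Coef.delta δ) k) = apOp p (Coef.delta δ) ∘L convL p k
    rw [apOp_delta, apOp_delta, convL_translation_left]
  exact DFunLike.congr_fun h a

theorem convL_apOp_right (a : Coef) (k : LpR 1) :
    convL p k ∘L apOp p a = apOp p a ∘L convL p k := by
  let C := ContinuousLinearMap.compL ℂ (LpR p) (LpR p) (LpR p)
  have h : C (convL p k) ∘L apOp p = C.flip (convL p k) ∘L apOp p := by
    refine Coef.hom_ext fun δ => ?_
    change convL p k ∘L apOp p (Coef.delta δ) = apOp p (Coef.delta δ) ∘L convL p k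
    rw [apOp_delta, convL_translation_right]
  exact DFunLike.congr_fun h a

theorem convL_convL (k l : LpR 1) : convL p (convL 1 k l) = convL p k ∘L convL p l := by
  ext1 f
  refine Lp.ext ?_
  have hn : ∀ {q : ℝ≥0∞} {u : ℝ → ℂ}, MemLp u q → MemLp (fun t => (‖u t‖ : ℂ)) q := by
    intro q u hu
    exact hu.norm.ofReal
  have hl' : Integrable (fun t => (‖l t‖ : ℂ)) := (integrable_L1 l).norm.ofReal
  have hk' : Integrable (fun t => (‖k t‖ : ℂ)) := (integrable_L1 k).norm.ofReal
  have hf' := hn (Lp.memLp f)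
  have hlf := memLp_conv (Fact.out : 1 ≤ p) hl' hf'
  filter_upwards [coeFn_convL p (convL 1 k l) f, coeFn_convL p k (convL p l f),
    conv_ae_exists (Fact.out : 1 ≤ p) hk' hlf] with t h1 h2 h3
  rw [ContinuousLinearMap.comp_apply, h1, h2,
    convolution_congr _ (coeFn_convL 1 k l) (EventuallyEq.refl _ f),
    convolution_congr _ (EventuallyEq.refl _ k) (coeFn_convL p l f)]
  refine convolution_assoc _ _ _ _ (fun x y z => mul_assoc x y z) (integrable_L1 k).1
    (integrable_L1 l).1 (Lp.memLp f).1
    (conv_ae_exists (Fact.out : 1 ≤ (1 : ℝ≥0∞)) (integrable_L1 k) (Lp.memLp l)) ?_ ?_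
  · filter_upwards [conv_ae_exists (Fact.out : 1 ≤ p) (integrable_L1 l) (Lp.memLp f)] with x hx
    have := hx.norm
    simpa [ConvolutionExistsAt] using this
  · have h4 : ∀ x : ℝ, convolution (fun t => (‖l t‖ : ℂ)) (fun t => (‖f t‖ : ℂ))
        (ContinuousLinearMap.mul ℂ ℂ) volume x =
        ((convolution (fun t => ‖l t‖) (fun t => ‖f t‖) (ContinuousLinearMap.mul ℝ ℝ) volume x : ℝ)
          : ℂ) := by
      intro x
      rw [convolution_def, convolution_def, ← integral_complex_ofReal]
      simp
    have h5 : Integrable fun s => ((‖k s‖ * convolution (fun t => ‖l t‖) (fun t => ‖f t‖)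
        (ContinuousLinearMap.mul ℝ ℝ) volume (t - s) : ℝ) : ℂ) := by
      simpa [ConvolutionExistsAt, h4] using h3
    simpa [ConvolutionExistsAt] using h5.re

end

noncomputable section

open Filter Topology

/-! ### Uniqueness of the coefficients and of the kernel -/

open FourierTransform in
/-- Pairing the function `∑_δ a_δ e^{iδt} + ∫ k(s) e^{ist} ds` with a rescaled inverse Fourier
transform of a test function `ψ` gives `∑_δ a_δ ψ(δ) + ∫ k ψ`. -/
theorem tsum_add_integral_schwartz_eq_zero {a : Coef} {k : ℝ → ℂ} (hk : Integrable k)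
    (h : ∀ t : ℝ, ∑' δ : ℝ, a δ * Complex.exp (Complex.I * δ * t) +
      ∫ s : ℝ, k s * Complex.exp (Complex.I * t * s) = 0) (ψ : SchwartzMap ℝ ℂ) :
    ∑' δ : ℝ, a δ * ψ δ + ∫ s : ℝ, k s * ψ s = 0 := by
  obtain ⟨φ, rfl⟩ : ∃ φ : SchwartzMap ℝ ℂ, 𝓕 φ = ψ :=
    ⟨𝓕⁻ ψ, FourierTransform.fourier_fourierInv_eq ψ⟩
  have hφ : ∀ w : ℝ, (𝓕 φ) w =
      ∫ v : ℝ, Complex.exp (Complex.I * w * (-2 * Real.pi * v : ℝ)) * φ v := by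
    intro w
    rw [SchwartzMap.fourier_coe, Real.fourier_eq']
    congr 1 with v
    rw [smul_eq_mul]
    congr 2
    simp only [RCLike.inner_apply, conj_trivial]
    push_cast
    ring
  have hk2 : ∀ w : ℝ, 𝓕 k w =
      ∫ s : ℝ, k s * Complex.exp (Complex.I * (-2 * Real.pi * w : ℝ) * s) := by
    intro w
    rw [Real.fourier_eq']
    congr 1 with v
    rw [smul_eq_mul, mul_comm]
    congr 2
    simp only [RCLike.inner_apply, conj_trivial]
    push_cast
    ring
  have hnorm : ∀ δ v : ℝ, ‖Complex.exp (Complex.I * δ * (-2 * Real.pi * v : ℝ))‖ = 1 := by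
    intro δ v
    rw [show Complex.I * δ * (-2 * Real.pi * v : ℝ) =
        ((δ * (-2 * Real.pi * v) : ℝ) : ℂ) * Complex.I by
      push_cast; ring, Complex.norm_exp_ofReal_mul_I]
  have hint : ∀ δ : ℝ, Integrable fun v : ℝ =>
      a δ * Complex.exp (Complex.I * δ * (-2 * Real.pi * v : ℝ)) * φ v := by
    intro δ
    refine φ.integrable.bdd_mul (c := ‖a δ‖) (by fun_prop) (.of_forall fun v => ?_)
    rw [norm_mul, hnorm, mul_one]
  have hcount : Countable (Function.support a) :=
    (Coef.summable_norm a).of_norm.countable_support.to_subtype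
  have h1 := hasSum_integral_of_summable_integral_norm
    (fun δ : Function.support a => hint δ) (by
    have : ∀ δ : ℝ, ∫ v : ℝ, ‖a δ * Complex.exp (Complex.I * δ * (-2 * Real.pi * v : ℝ)) * φ v‖
        = ‖a δ‖ * ∫ v, ‖φ v‖ := by
      intro δ
      rw [← integral_const_mul]
      congr 1 with v
      rw [norm_mul, norm_mul, hnorm, mul_one]
    simp_rw [this]
    exact ((Coef.summable_norm a).subtype _).mul_right _)
  have hsub : ∀ w : ℝ → ℂ, ∑' δ : Function.support a, a δ * w δ = ∑' δ : ℝ, a δ * w δ := fun w =>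
    tsum_subtype_eq_of_support_subset (f := fun δ => a δ * w δ)
      fun δ hδ => left_ne_zero_of_mul hδ
  have h2 : ∫ v : ℝ, 𝓕 k v • φ v = ∫ s : ℝ, k s • (𝓕 φ) s := by
    rw [SchwartzMap.fourier_coe]
    simpa using! VectorFourier.integral_fourierIntegral_smul_eq_flip (L := innerₗ ℝ)
      Real.continuous_fourierChar continuous_inner hk φ.integrable
  have h4 : ∫ v : ℝ, ∑' δ : Function.support a,
      a δ * Complex.exp (Complex.I * δ * (-2 * Real.pi * v : ℝ)) * φ v
      = - ∫ v : ℝ, 𝓕 k v • φ v := by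
    rw [← integral_neg]
    congr 1 with v
    rw [tsum_mul_right, hsub fun δ => Complex.exp (Complex.I * δ * (-2 * Real.pi * v : ℝ)),
      smul_eq_mul, ← neg_mul]
    congr 1
    rw [hk2, eq_neg_iff_add_eq_zero]
    exact h _
  rw [h4, h2] at h1
  have h5 := h1.tsum_eq
  have h6 : ∑' δ : ℝ, a δ * (𝓕 φ) δ = - ∫ s : ℝ, k s • (𝓕 φ) s := by
    rw [← h5]
    refine (hsub fun δ => (𝓕 φ) δ).symm.trans ?_
    congr 1 with δ
    rw [hφ, ← integral_const_mul]
    simp only [mul_assoc]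
  rw [h6]
  simp

/-- The function `∑_δ a_δ e^{iδt} + ∫ k(s) e^{ist} ds` vanishes only if all its coefficients and
almost every value of its kernel do: test functions supported near `δ` isolate `a_δ`. -/
theorem coef_eq_zero_and_kernel_ae_eq_zero {a : Coef} {k : ℝ → ℂ} (hk : Integrable k)
    (h : ∀ t : ℝ, ∑' δ : ℝ, a δ * Complex.exp (Complex.I * δ * t) +
      ∫ s : ℝ, k s * Complex.exp (Complex.I * t * s) = 0) :
    a = 0 ∧ ∀ᵐ s : ℝ, k s = 0 := by
  have key : ∀ ψ : ℝ → ℝ, ContDiff ℝ (⊤ : ℕ∞) ψ → HasCompactSupport ψ →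
      ∑' δ : ℝ, a δ * (ψ δ : ℂ) + ∫ s : ℝ, k s * (ψ s : ℂ) = 0 := by
    intro ψ hψ hc
    have hc' : HasCompactSupport fun s => (ψ s : ℂ) :=
      hc.comp_left (g := fun x : ℝ => (x : ℂ)) (by simp)
    have hψ' : ContDiff ℝ (⊤ : ℕ∞) fun s => (ψ s : ℂ) := Complex.ofRealCLM.contDiff.comp hψ
    exact tsum_add_integral_schwartz_eq_zero hk h (hc'.toSchwartzMap hψ')
  have ha : a = 0 := by
    ext γ
    -- bump functions at `γ` with supports shrinking to `{γ}`
    have hex : ∀ n : ℕ, ∃ f : ℝ → ℝ, tsupport f ⊆ Metric.ball γ (1 / (n + 1 : ℝ)) ∧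
        HasCompactSupport f ∧ ContDiff ℝ (⊤ : ℕ∞) f ∧ Set.range f ⊆ Set.Icc 0 1 ∧ f γ = 1 :=
      fun n => exists_contDiff_tsupport_subset (Metric.ball_mem_nhds γ (by positivity))
    choose f hf1 hf2 hf3 hf4 hf5 using hex
    have hb : ∀ n s, ‖(f n s : ℂ)‖ ≤ 1 := by
      intro n s
      have := hf4 n (Set.mem_range_self s)
      rw [Complex.norm_real, Real.norm_eq_abs, abs_of_nonneg this.1]
      exact this.2
    have hlim : ∀ s, s ≠ γ → Tendsto (fun n => (f n s : ℂ)) atTop (𝓝 0) := by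
      intro s hs
      refine tendsto_const_nhds.congr' ?_
      have hd : 0 < dist s γ := dist_pos.2 hs
      filter_upwards [tendsto_one_div_add_atTop_nhds_zero_nat.eventually (gt_mem_nhds hd)] with n hn
      have : s ∉ tsupport (f n) := fun hmem => by
        have := hf1 n hmem
        rw [Metric.mem_ball] at this
        linarith
      rw [image_eq_zero_of_notMem_tsupport this, Complex.ofReal_zero]
    have hlim1 : Tendsto (fun n => ∑' δ : ℝ, a δ * (f n δ : ℂ)) atTop
        (𝓝 (∑' δ : ℝ, if δ = γ then a γ else 0)) := by
      refine tendsto_tsum_of_dominated_convergence (Coef.summable_norm a) (fun δ => ?_)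
        (.of_forall fun n δ => ?_)
      · by_cases hδ : δ = γ
        · subst hδ; simp [hf5]
        · simpa [hδ] using (hlim δ hδ).const_mul (a δ)
      · rw [norm_mul]
        exact mul_le_of_le_one_right (norm_nonneg _) (hb n δ)
    have hlim2 : Tendsto (fun n => ∫ s : ℝ, k s * (f n s : ℂ)) atTop (𝓝 (∫ s : ℝ, (0 : ℂ))) := by
      refine tendsto_integral_of_dominated_convergence (fun s => ‖k s‖) (fun n => ?_) hk.norm
        (fun n => .of_forall fun s => ?_) ?_
      · exact hk.1.mul (Complex.continuous_ofReal.comp (hf3 n).continuous).aestronglyMeasurable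
      · rw [norm_mul]
        exact mul_le_of_le_one_right (norm_nonneg _) (hb n s)
      · filter_upwards [Measure.ae_ne volume γ] with s hs
        simpa using (hlim s hs).const_mul (k s)
    have hsum := hlim1.add hlim2
    rw [integral_zero, add_zero, tsum_ite_eq] at hsum
    have hz : (fun n => ∑' δ : ℝ, a δ * (f n δ : ℂ) + ∫ s : ℝ, k s * (f n s : ℂ)) = fun _ => 0 :=
      funext fun n => key _ (hf3 n) (hf2 n)
    rw [hz] at hsum
    simpa using (tendsto_nhds_unique hsum tendsto_const_nhds)
  refine ⟨ha, ?_⟩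
  refine ae_eq_zero_of_integral_contDiff_smul_eq_zero hk.locallyIntegrable fun ψ hψ hc => ?_
  have := key ψ hψ hc
  rw [ha] at this
  simpa [mul_comm] using this

end

noncomputable section

open Filter Topology

/-! ### The Banach algebra `ℓ¹(ℝ) ⊕ L¹(ℝ)` -/

/-- The value `∑_δ a_δ e^{iδt}`, as a function of the family `a`. -/
def evCoef (t : ℝ) : Coef →L[ℂ] ℂ :=
  Coef.sumL (fun δ => Complex.exp (Complex.I * δ * t)) fun δ => by
    rw [show Complex.I * δ * t = ((δ * t : ℝ) : ℂ) * Complex.I by push_cast; ring,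
      Complex.norm_exp_ofReal_mul_I]

theorem evCoef_apply (t : ℝ) (a : Coef) :
    evCoef t a = ∑' δ : ℝ, a δ * Complex.exp (Complex.I * δ * t) := rfl

theorem evCoef_delta (t δ : ℝ) : evCoef t (Coef.delta δ) = Complex.exp (Complex.I * δ * t) :=
  Coef.sumL_delta _ _ _

theorem norm_evCoef_apply_le (t : ℝ) (a : Coef) : ‖evCoef t a‖ ≤ ‖a‖ :=
  Coef.norm_sumL_apply_le _ _ a

theorem evCoef_conv (t : ℝ) (a b : Coef) : evCoef t (Coef.conv a b) = evCoef t a * evCoef t b := by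
  have h : (ContinuousLinearMap.compL ℂ Coef Coef ℂ (evCoef t)) ∘L Coef.conv
      = ((ContinuousLinearMap.mul ℂ ℂ ∘L evCoef t).flip ∘L evCoef t).flip := by
    refine Coef.hom_ext fun δ => Coef.hom_ext fun ε => ?_
    change evCoef t (Coef.conv (Coef.delta δ) (Coef.delta ε)) =
      evCoef t (Coef.delta δ) * evCoef t (Coef.delta ε)
    rw [Coef.conv_delta_delta, evCoef_delta, evCoef_delta, evCoef_delta, ← Complex.exp_add]
    congr 1; push_cast; ring
  exact DFunLike.congr_fun (DFunLike.congr_fun h a) b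

theorem norm_exp_I_mul (t s : ℝ) : ‖Complex.exp (Complex.I * t * s)‖ = 1 := by
  rw [show Complex.I * t * s = ((t * s : ℝ) : ℂ) * Complex.I by push_cast; ring,
    Complex.norm_exp_ofReal_mul_I]

theorem integrable_mul_exp {k : ℝ → ℂ} (hk : Integrable k) (t : ℝ) :
    Integrable fun s : ℝ => k s * Complex.exp (Complex.I * t * s) := by
  refine hk.mul_bdd (c := 1) ?_ (.of_forall fun s => (norm_exp_I_mul t s).le)
  exact (by fun_prop : Continuous fun s : ℝ => Complex.exp (Complex.I * t * s)).aestronglyMeasurable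

/-- The value `∫ k(s) e^{its} ds`, as a function of the kernel `k`. -/
def evKern (t : ℝ) : LpR 1 →L[ℂ] ℂ :=
  LinearMap.mkContinuous
    { toFun := fun k => ∫ s : ℝ, k s * Complex.exp (Complex.I * t * s)
      map_add' := fun k l => by
        rw [← integral_add (integrable_mul_exp (integrable_L1 k) t)
          (integrable_mul_exp (integrable_L1 l) t)]
        refine integral_congr_ae ?_
        filter_upwards [Lp.coeFn_add k l] with s hs
        rw [hs, Pi.add_apply, add_mul]
      map_smul' := fun c k => by
        rw [RingHom.id_apply, smul_eq_mul, ← integral_const_mul]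
        refine integral_congr_ae ?_
        filter_upwards [Lp.coeFn_smul c k] with s hs
        rw [hs, Pi.smul_apply, smul_eq_mul, mul_assoc] }
    1
    (fun k => by
      rw [one_mul, L1.norm_eq_integral_norm]
      refine (norm_integral_le_integral_norm _).trans (le_of_eq ?_)
      congr 1 with s
      rw [norm_mul, norm_exp_I_mul, mul_one])

theorem evKern_apply (t : ℝ) (k : LpR 1) :
    evKern t k = ∫ s : ℝ, k s * Complex.exp (Complex.I * t * s) := rfl

theorem norm_evKern_apply_le (t : ℝ) (k : LpR 1) : ‖evKern t k‖ ≤ ‖k‖ :=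
  ((evKern t).le_of_opNorm_le (LinearMap.mkContinuous_norm_le _ zero_le_one _) k).trans
    (one_mul _).le

theorem evKern_translation (t δ : ℝ) (k : LpR 1) :
    evKern t (translation 1 δ k) = Complex.exp (Complex.I * δ * t) * evKern t k := by
  rw [evKern_apply, evKern_apply, ← integral_const_mul,
    ← integral_sub_right_eq_self
      (fun s : ℝ => Complex.exp (Complex.I * δ * t) * (k s * Complex.exp (Complex.I * t * s))) δ]
  refine integral_congr_ae ?_
  filter_upwards [coeFn_translation 1 δ k] with s hs
  rw [hs, mul_left_comm, ← Complex.exp_add]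
  congr 2; push_cast; ring

theorem evKern_apOp (t : ℝ) (a : Coef) (k : LpR 1) :
    evKern t (apOp 1 a k) = evCoef t a * evKern t k := by
  have h : evKern t ∘L (apOp 1).flip k =
      ((ContinuousLinearMap.mul ℂ ℂ).flip (evKern t k)) ∘L evCoef t := by
    refine Coef.hom_ext fun δ => ?_
    change evKern t (apOp 1 (Coef.delta δ) k) = evCoef t (Coef.delta δ) * evKern t k
    rw [apOp_delta, evKern_translation, evCoef_delta]
  exact DFunLike.congr_fun h a

theorem evKern_convL (t : ℝ) (k l : LpR 1) :
    evKern t (convL 1 k l) = evKern t k * evKern t l := by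
  have h := MeasureTheory.integral_convolution (ContinuousLinearMap.mul ℂ ℂ)
    (integrable_mul_exp (integrable_L1 k) t) (integrable_mul_exp (integrable_L1 l) t)
  rw [ContinuousLinearMap.mul_apply'] at h
  rw [evKern_apply, evKern_apply, evKern_apply, ← h]
  refine integral_congr_ae ?_
  filter_upwards [coeFn_convL 1 k l] with s hs
  rw [hs, convolution_def, convolution_def, ← integral_mul_const]
  congr 1 with r
  simp only [ContinuousLinearMap.mul_apply']
  rw [show Complex.I * t * s = Complex.I * t * r + Complex.I * t * ((s - r : ℝ) : ℂ) by
    push_cast; ring, Complex.exp_add]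
  ring

/-- The Banach algebra of the measures `∑_δ a_δ ε_δ + k(s) ds` with convolution as its product. Its
elements are pairs `(a, k)` with `a ∈ ℓ¹(ℝ)` and `k ∈ L¹(ℝ)`, normed by `‖a‖ + ‖k‖`. -/
def Alg : Type := WithLp 1 (Coef × LpR 1)

namespace Alg

instance : NormedAddCommGroup Alg := inferInstanceAs (NormedAddCommGroup (WithLp 1 (Coef × LpR 1)))

instance : NormedSpace ℂ Alg := inferInstanceAs (NormedSpace ℂ (WithLp 1 (Coef × LpR 1)))

instance : CompleteSpace Alg := inferInstanceAs (CompleteSpace (WithLp 1 (Coef × LpR 1)))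

/-- The element with coefficients `a` and kernel `k`. -/
def mk (a : Coef) (k : LpR 1) : Alg := WithLp.toLp 1 (a, k)

/-- The coefficients of an element. -/
def coef : Alg →L[ℂ] Coef := WithLp.fstL 1 ℂ Coef (LpR 1)

/-- The kernel of an element. -/
def kern : Alg →L[ℂ] LpR 1 := WithLp.sndL 1 ℂ Coef (LpR 1)

@[simp] theorem coef_mk (a : Coef) (k : LpR 1) : coef (mk a k) = a := rfl

@[simp] theorem kern_mk (a : Coef) (k : LpR 1) : kern (mk a k) = k := rfl

theorem ext {x y : Alg} (h1 : coef x = coef y) (h2 : kern x = kern y) : x = y := by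
  apply (WithLp.equiv 1 (Coef × LpR 1)).injective
  exact Prod.ext h1 h2

theorem norm_eq (x : Alg) : ‖x‖ = ‖coef x‖ + ‖kern x‖ :=
  WithLp.prod_norm_eq_of_L1 (α := Coef) (β := LpR 1) x

/-- The value at `t` of the function `∑_δ a_δ e^{iδt} + ∫ k(s) e^{its} ds`. -/
def ev (t : ℝ) : Alg →L[ℂ] ℂ := evCoef t ∘L coef + evKern t ∘L kern

theorem ev_apply (t : ℝ) (x : Alg) : ev t x = evCoef t (coef x) + evKern t (kern x) := rfl

theorem ev_injective {x y : Alg} (h : ∀ t, ev t x = ev t y) : x = y := by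
  rw [← sub_eq_zero]
  set z := x - y with hz
  have h0 : ∀ t, ev t z = 0 := fun t => by rw [hz, map_sub, h, sub_self]
  obtain ⟨h1, h2⟩ := coef_eq_zero_and_kernel_ae_eq_zero (a := coef z) (integrable_L1 (kern z)) h0
  refine ext (by rw [h1, map_zero]) ?_
  rw [map_zero]
  exact (Lp.eq_zero_iff_ae_eq_zero).2 h2

/-- Convolution of measures: `L¹(ℝ)` is an ideal, on which the coefficients act by translations. -/
instance : Mul Alg :=
  ⟨fun x y => mk (Coef.conv (coef x) (coef y))
    (apOp 1 (coef x) (kern y) + apOp 1 (coef y) (kern x) + convL 1 (kern x) (kern y))⟩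

instance : One Alg := ⟨mk (Coef.delta 0) 0⟩

@[simp] theorem coef_mul (x y : Alg) : coef (x * y) = Coef.conv (coef x) (coef y) := rfl

@[simp] theorem kern_mul (x y : Alg) : kern (x * y) =
    apOp 1 (coef x) (kern y) + apOp 1 (coef y) (kern x) + convL 1 (kern x) (kern y) := rfl

@[simp] theorem coef_one : coef 1 = Coef.delta 0 := rfl

@[simp] theorem kern_one : kern 1 = 0 := rfl

theorem ev_mul' (t : ℝ) (x y : Alg) : ev t (x * y) = ev t x * ev t y := by
  simp only [ev_apply, coef_mul, kern_mul, map_add, evCoef_conv, evKern_apOp, evKern_convL]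
  ring

theorem ev_one' (t : ℝ) : ev t 1 = 1 := by
  simp [ev_apply, evCoef_delta]

/-- The ring axioms hold pointwise, hence in `Alg` by `ev_injective`. -/
instance : CommRing Alg :=
  { (inferInstance : AddCommGroup Alg), (inferInstance : Mul Alg), (inferInstance : One Alg) with
    left_distrib := fun x y z => ev_injective fun t => by simp only [ev_mul', map_add]; ring
    right_distrib := fun x y z => ev_injective fun t => by simp only [ev_mul', map_add]; ring
    zero_mul := fun x => ev_injective fun t => by simp only [ev_mul', map_zero, zero_mul]
    mul_zero := fun x => ev_injective fun t => by simp only [ev_mul', map_zero, mul_zero]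
    mul_assoc := fun x y z => ev_injective fun t => by simp only [ev_mul', mul_assoc]
    one_mul := fun x => ev_injective fun t => by simp only [ev_mul', ev_one', one_mul]
    mul_one := fun x => ev_injective fun t => by simp only [ev_mul', ev_one', mul_one]
    mul_comm := fun x y => ev_injective fun t => by simp only [ev_mul', mul_comm] }

instance : NormedCommRing Alg :=
  { (inferInstance : NormedAddCommGroup Alg), (inferInstance : CommRing Alg) with
    norm_mul_le := fun x y => by
      rw [norm_eq, norm_eq x, norm_eq y, coef_mul, kern_mul]
      have h1 := Coef.norm_conv_le (coef x) (coef y)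
      have h2 := norm_apOp_le 1 (coef x) (kern y)
      have h3 := norm_apOp_le 1 (coef y) (kern x)
      have h4 := norm_convL_apply_le 1 (kern x) (kern y)
      have h5 := norm_add₃_le (a := apOp 1 (coef x) (kern y)) (b := apOp 1 (coef y) (kern x))
        (c := convL 1 (kern x) (kern y))
      nlinarith }

instance : NormOneClass Alg := ⟨by rw [norm_eq]; simp [Coef.norm_delta]⟩

instance : NormedAlgebra ℂ Alg :=
  { Algebra.ofModule
      (fun c x y => ev_injective fun t => by simp only [ev_mul', map_smul, smul_eq_mul]; ring)
      (fun c x y => ev_injective fun t => by simp only [ev_mul', map_smul, smul_eq_mul]; ring) with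
    norm_smul_le := norm_smul_le }

instance : NormedAlgebra ℚ Alg := NormedAlgebra.restrictScalars ℚ ℂ Alg

/-- Evaluation at `t` as a character. -/
def evHom (t : ℝ) : Alg →ₐ[ℂ] ℂ :=
  AlgHom.ofLinearMap (ev t) (ev_one' t) (ev_mul' t)

@[simp] theorem ev_mul (t : ℝ) (x y : Alg) : ev t (x * y) = ev t x * ev t y := ev_mul' t x y

@[simp] theorem ev_one (t : ℝ) : ev t 1 = 1 := ev_one' t

theorem ev_exp (t : ℝ) (x : Alg) : ev t (NormedSpace.exp x) = Complex.exp (ev t x) := by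
  rw [Complex.exp_eq_exp_ℂ]
  exact NormedSpace.map_exp (evHom t) (ev t).continuous x

end Alg

end

noncomputable section

open Filter Topology

/-! ### The representation on `L^p(ℝ)` -/

namespace Alg

/-- The operator `W⁰` on `L^p(ℝ)`, as a function on the Banach algebra. -/
def op (p : ℝ≥0∞) [Fact (1 ≤ p)] : Alg →L[ℂ] LpR p →L[ℂ] LpR p := apOp p ∘L coef + convL p ∘L kern

section op

variable (p : ℝ≥0∞) [Fact (1 ≤ p)]

theorem op_apply (x : Alg) : op p x = apOp p (coef x) + convL p (kern x) := rfl

theorem op_mul (x y : Alg) : op p (x * y) = op p x ∘L op p y := by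
  simp only [op_apply, coef_mul, kern_mul, map_add, apOp_conv, convL_apOp_left, convL_convL,
    ContinuousLinearMap.add_comp, ContinuousLinearMap.comp_add, convL_apOp_right]
  abel

theorem op_mul_apply (x y : Alg) (f : LpR p) : op p (x * y) f = op p x (op p y f) := by
  rw [op_mul, ContinuousLinearMap.comp_apply]

theorem op_one_apply (f : LpR p) : op p 1 f = f := by
  have h : translation p 0 f = f := by
    refine Lp.ext ?_
    filter_upwards [coeFn_translation p 0 f] with t ht
    rw [ht, sub_zero]
  rw [op_apply, coef_one, kern_one, map_zero, add_zero, apOp_delta, h]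

end op

/-- The element with the coefficients and the kernel of `a`. -/
def ofG (a : G) : Alg :=
  mk (Coef.of a.coeff a.summable_coeff) (a.integrable_kern.toL1 a.kern)

theorem kern_ofG (a : G) : kern (ofG a) =ᵐ[volume] a.kern := a.integrable_kern.coeFn_toL1

theorem evCoef_ofG (a : G) (t : ℝ) : evCoef t (coef (ofG a)) = a.apPart t := rfl

theorem evKern_ofG (a : G) (t : ℝ) : evKern t (kern (ofG a)) = a.fourierPart t := by
  rw [evKern_apply, G.fourierPart]
  refine integral_congr_ae ?_
  filter_upwards [kern_ofG a] with s hs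
  rw [hs]

theorem ev_ofG (a : G) (t : ℝ) : ev t (ofG a) = a t := by
  rw [ev_apply, evCoef_ofG, evKern_ofG]; rfl

theorem op_ofG (p : ℝ≥0∞) [Fact (1 ≤ p)] (a : G) : op p (ofG a) = W0 p a := by
  rw [op_apply, W0, convL_apply,
    convOp_congr p (integrable_L1 (kern (ofG a))) a.integrable_kern (kern_ofG a)]
  rfl

/-- A representative in `G` of an element of the Banach algebra. -/
def toG (x : Alg) : G := ⟨coef x, kern x, Coef.summable_norm _, integrable_L1 _⟩

theorem ofG_toG (x : Alg) : ofG (toG x) = x := by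
  refine ext rfl (Lp.ext ?_)
  exact kern_ofG (toG x)

theorem toG_apply (x : Alg) (t : ℝ) : toG x t = ev t x := by
  rw [← ev_ofG, ofG_toG]

end Alg

/-! ### Functions supported on a half-line -/

theorem ae_of_ae_lt_of_ae_gt {P : ℝ → Prop} (h1 : ∀ᵐ t : ℝ, t < 0 → P t)
    (h2 : ∀ᵐ t : ℝ, 0 < t → P t) : ∀ᵐ t : ℝ, P t := by
  filter_upwards [h1, h2, Measure.ae_ne volume (0 : ℝ)] with t ht1 ht2 ht3
  rcases lt_or_gt_of_ne ht3 with h | h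
  exacts [ht1 h, ht2 h]

theorem mem_LpPlus {p : ℝ≥0∞} {f : LpR p} : f ∈ LpPlus p ↔ ∀ᵐ t : ℝ, t < 0 → f t = 0 := Iff.rfl

section HalfLine

variable (p : ℝ≥0∞) [Fact (1 ≤ p)]

theorem coeFn_projP (f : LpR p) : projP p f =ᵐ[volume] (Set.Ioi (0 : ℝ)).indicator f :=
  coeFn_indicatorOp p _ _ f

theorem coeFn_projQ (f : LpR p) : projQ p f =ᵐ[volume] (Set.Iio (0 : ℝ)).indicator f :=
  coeFn_indicatorOp p _ _ f

/-- The functions in `L^p(ℝ)` that vanish on the positive semi-axis, as the reflections of the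
functions that vanish on the negative one. -/
def LpMinus : Submodule ℂ (LpR p) := (LpPlus p).comap (reflect p : LpR p →ₗ[ℂ] LpR p)

variable {p}

theorem reflect_reflect (f : LpR p) : reflect p (reflect p f) = f := by
  refine Lp.ext ?_
  filter_upwards [coeFn_reflect p (reflect p f), ae_comp_neg (coeFn_reflect p f)] with t h1 h2
  rw [h1, h2, neg_neg]

theorem mem_LpMinus_iff_reflect {f : LpR p} : f ∈ LpMinus p ↔ reflect p f ∈ LpPlus p := Iff.rfl

theorem reflect_mem_LpMinus {f : LpR p} : reflect p f ∈ LpMinus p ↔ f ∈ LpPlus p := by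
  rw [mem_LpMinus_iff_reflect, reflect_reflect]

theorem mem_LpMinus {f : LpR p} : f ∈ LpMinus p ↔ ∀ᵐ t : ℝ, 0 < t → f t = 0 := by
  rw [mem_LpMinus_iff_reflect, mem_LpPlus]
  constructor <;> intro h
  · filter_upwards [ae_comp_neg h, ae_comp_neg (coeFn_reflect p f)] with t h1 h2 ht
    rw [← h1 (by simpa using ht), h2, neg_neg]
  · filter_upwards [ae_comp_neg h, coeFn_reflect p f] with t h1 h2 ht
    rw [h2, h1 (by simpa using ht)]

theorem projQ_eq_zero_iff {f : LpR p} : projQ p f = 0 ↔ f ∈ LpPlus p := by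
  rw [Lp.eq_zero_iff_ae_eq_zero, mem_LpPlus]
  constructor <;> intro h
  · filter_upwards [h, coeFn_projQ p f] with t h1 h2 ht
    rw [h1, Pi.zero_apply, Set.indicator_of_mem (Set.mem_Iio.2 ht)] at h2
    exact h2.symm
  · filter_upwards [h, coeFn_projQ p f] with t h1 h2
    rw [h2, Pi.zero_apply, Set.indicator_apply_eq_zero]
    exact h1

theorem projP_eq_zero_iff {f : LpR p} : projP p f = 0 ↔ f ∈ LpMinus p := by
  rw [Lp.eq_zero_iff_ae_eq_zero, mem_LpMinus]
  constructor <;> intro h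
  · filter_upwards [h, coeFn_projP p f] with t h1 h2 ht
    rw [h1, Pi.zero_apply, Set.indicator_of_mem (Set.mem_Ioi.2 ht)] at h2
    exact h2.symm
  · filter_upwards [h, coeFn_projP p f] with t h1 h2
    rw [h2, Pi.zero_apply, Set.indicator_apply_eq_zero]
    exact h1

theorem projP_of_mem {f : LpR p} (hf : f ∈ LpPlus p) : projP p f = f := by
  refine Lp.ext (ae_of_ae_lt_of_ae_gt ?_ ?_)
  · filter_upwards [mem_LpPlus.1 hf, coeFn_projP p f] with t h1 h2 ht
    rw [h2, h1 ht, Set.indicator_of_notMem (by simpa using ht.le)]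
  · filter_upwards [coeFn_projP p f] with t h2 ht
    rw [h2, Set.indicator_of_mem (Set.mem_Ioi.2 ht)]

theorem projQ_of_mem {f : LpR p} (hf : f ∈ LpMinus p) : projQ p f = f := by
  refine Lp.ext (ae_of_ae_lt_of_ae_gt ?_ ?_)
  · filter_upwards [coeFn_projQ p f] with t h2 ht
    rw [h2, Set.indicator_of_mem (Set.mem_Iio.2 ht)]
  · filter_upwards [mem_LpMinus.1 hf, coeFn_projQ p f] with t h1 h2 ht
    rw [h2, h1 ht, Set.indicator_of_notMem (by simpa using ht.le)]

theorem translation_mem_LpPlus {δ : ℝ} (hδ : 0 ≤ δ) {f : LpR p} (hf : f ∈ LpPlus p) :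
    translation p δ f ∈ LpPlus p := by
  rw [mem_LpPlus] at hf ⊢
  filter_upwards [ae_comp_sub hf δ, coeFn_translation p δ f] with t h1 h2 ht
  rw [h2, h1 (by linarith)]

theorem apOp_mem_LpPlus {a : Coef} (ha : ∀ δ < 0, a δ = 0) {f : LpR p} (hf : f ∈ LpPlus p) :
    apOp p a f ∈ LpPlus p := by
  rw [← projQ_eq_zero_iff]
  have h := (Coef.summable_norm_smul (translation p) (norm_translation_le p) a).of_norm.hasSum
  have h2 := (projQ p ∘L ContinuousLinearMap.apply ℂ (LpR p) f).hasSum h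
  refine h2.unique ?_
  convert! hasSum_zero with δ
  rcases lt_or_ge δ 0 with hδ | hδ
  · simp [ha δ hδ]
  · simp [projQ_eq_zero_iff.2 (translation_mem_LpPlus hδ hf)]

theorem convL_mem_LpPlus {k : LpR 1} (hk : k ∈ LpPlus 1) {f : LpR p} (hf : f ∈ LpPlus p) :
    convL p k f ∈ LpPlus p := by
  rw [mem_LpPlus] at hk hf ⊢
  filter_upwards [coeFn_convL p k f] with t h1 ht
  rw [h1, convolution_def]
  refine integral_eq_zero_of_ae ?_
  have hf' := (quasiMeasurePreserving_sub_left (volume : Measure ℝ) t).ae hf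
  filter_upwards [hk, hf'] with s hs1 hs2
  rcases lt_or_ge s 0 with h | h
  · simp [hs1 h]
  · simp [hs2 (by linarith)]

end HalfLine

/-! ### The closed subalgebras of one-sided elements, and reflection -/

namespace Alg

/-- An element of a closed subalgebra has its exponential there. -/
theorem exp_mem {S : Subalgebra ℂ Alg} (hS : IsClosed (S : Set Alg)) {x : Alg} (hx : x ∈ S) :
    NormedSpace.exp x ∈ S :=
  hS.mem_of_tendsto (NormedSpace.exp_series_hasSum_exp' (𝕂 := ℂ) x)
    (.of_forall fun _ => S.sum_mem fun n _ => S.smul_mem (S.pow_mem hx n) _)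

/-- The subalgebra of elements whose coefficients and kernel are supported on `[0, ∞)`. -/
def plus : Subalgebra ℂ Alg where
  carrier := {x | (∀ δ < 0, coef x δ = 0) ∧ kern x ∈ LpPlus 1}
  mul_mem' := fun {x y} hx hy => by
    refine ⟨fun γ hγ => ?_, ?_⟩
    · rw [coef_mul]
      refine (Coef.hasSum_conv (coef x) (coef y) γ).unique ?_
      convert! hasSum_zero with δ
      rcases lt_or_ge δ 0 with hδ | hδ
      · simp [hx.1 δ hδ]
      · simp [hy.1 (γ - δ) (by linarith)]
    · rw [kern_mul]
      exact add_mem (add_mem (apOp_mem_LpPlus hx.1 hy.2) (apOp_mem_LpPlus hy.1 hx.2))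
        (convL_mem_LpPlus hx.2 hy.2)
  add_mem' := fun {x y} hx hy => by
    refine ⟨fun γ hγ => ?_, ?_⟩
    · rw [map_add, lp.coeFn_add, Pi.add_apply, hx.1 γ hγ, hy.1 γ hγ, add_zero]
    · rw [map_add]; exact add_mem hx.2 hy.2
  algebraMap_mem' := fun c => by
    rw [Algebra.algebraMap_eq_smul_one]
    refine ⟨fun γ hγ => ?_, ?_⟩
    · simp [Coef.delta_apply, hγ.ne]
    · simp

theorem mem_plus {x : Alg} : x ∈ plus ↔ (∀ δ < 0, coef x δ = 0) ∧ kern x ∈ LpPlus 1 := Iff.rfl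

theorem isClosed_plus : IsClosed (plus : Set Alg) := by
  have : (plus : Set Alg) = (⋂ δ ∈ Set.Iio (0 : ℝ), {x | Coef.evalL δ (coef x) = 0}) ∩
      {x | projQ 1 (kern x) = 0} := by
    ext x
    simp [mem_plus, projQ_eq_zero_iff]
  rw [this]
  refine IsClosed.inter (isClosed_biInter fun δ _ => ?_) ?_
  · exact isClosed_eq ((Coef.evalL δ).continuous.comp coef.continuous) continuous_const
  · exact isClosed_eq ((projQ 1).continuous.comp kern.continuous) continuous_const

theorem op_mem_LpPlus {p : ℝ≥0∞} [Fact (1 ≤ p)] {x : Alg} (hx : x ∈ plus) {f : LpR p}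
    (hf : f ∈ LpPlus p) : op p x f ∈ LpPlus p :=
  add_mem (apOp_mem_LpPlus hx.1 hf) (convL_mem_LpPlus hx.2 hf)

/-- The reflection `a_δ ↦ a_{-δ}` of families. -/
def reflCoef : Coef →L[ℂ] Coef :=
  Coef.sumL (fun δ => Coef.delta (-δ)) fun _ => (Coef.norm_delta _).le

theorem reflCoef_apply (a : Coef) (δ : ℝ) : reflCoef a δ = a (-δ) := by
  have h : Coef.evalL δ ∘L reflCoef = Coef.evalL (-δ) := by
    refine Coef.hom_ext fun ε => ?_
    simp only [ContinuousLinearMap.comp_apply, reflCoef, Coef.sumL_delta, Coef.evalL_apply,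
      Coef.delta_apply]
    congr 1
    rw [eq_iff_iff]
    constructor <;> intro h <;> linarith
  exact DFunLike.congr_fun h a

/-- The element representing `t ↦ x(-t)`. -/
def refl (x : Alg) : Alg := mk (reflCoef (coef x)) (reflect 1 (kern x))

theorem ev_refl (t : ℝ) (x : Alg) : ev t (refl x) = ev (-t) x := by
  have h1 : evCoef t ∘L reflCoef = evCoef (-t) := by
    refine Coef.hom_ext fun ε => ?_
    simp only [ContinuousLinearMap.comp_apply, reflCoef, Coef.sumL_delta, evCoef_delta]
    congr 1; push_cast; ring
  have h2 : ∀ k : LpR 1, evKern t (reflect 1 k) = evKern (-t) k := by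
    intro k
    rw [evKern_apply, evKern_apply,
      ← integral_neg_eq_self (fun s : ℝ => k s * Complex.exp (Complex.I * (-t : ℝ) * s))]
    refine integral_congr_ae ?_
    filter_upwards [coeFn_reflect 1 k] with s hs
    rw [hs]
    congr 2; push_cast; ring
  rw [ev_apply, ev_apply, refl, coef_mk, kern_mk, h2, ← h1]
  rfl

theorem refl_mul (x y : Alg) : refl (x * y) = refl x * refl y :=
  ev_injective fun t => by simp only [ev_refl, ev_mul]

theorem refl_refl (x : Alg) : refl (refl x) = x :=
  ev_injective fun t => by simp only [ev_refl, neg_neg]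

theorem refl_one : refl 1 = 1 :=
  ev_injective fun t => by simp only [ev_refl, ev_one]

theorem op_refl (p : ℝ≥0∞) [Fact (1 ≤ p)] (x : Alg) (f : LpR p) :
    op p (refl x) f = reflect p (op p x (reflect p f)) := by
  have h1 : ∀ a : Coef, apOp p (reflCoef a) f = reflect p (apOp p a (reflect p f)) := by
    intro a
    have h : (apOp p ∘L reflCoef).flip f =
        reflect p ∘L (apOp p).flip (reflect p f) := by
      refine Coef.hom_ext fun δ => ?_
      change apOp p (reflCoef (Coef.delta δ)) f = reflect p (apOp p (Coef.delta δ) (reflect p f))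
      rw [reflCoef, Coef.sumL_delta, apOp_delta, apOp_delta]
      refine Lp.ext ?_
      filter_upwards [coeFn_translation p (-δ) f,
        coeFn_reflect p (translation p δ (reflect p f)),
        ae_comp_neg (coeFn_translation p δ (reflect p f)),
        ae_comp_neg (ae_comp_sub (coeFn_reflect p f) δ)] with t h1 h2 h3 h4
      rw [h1, h2, h3, h4]
      congr 1; ring
    exact DFunLike.congr_fun h a
  have h2 : convL p (reflect 1 (kern x)) f = reflect p (convL p (kern x) (reflect p f)) := by
    refine Lp.ext ?_
    filter_upwards [coeFn_convL p (reflect 1 (kern x)) f,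
      coeFn_reflect p (convL p (kern x) (reflect p f)),
      ae_comp_neg (coeFn_convL p (kern x) (reflect p f))] with t h1 h2 h3
    rw [h1, h2, h3, convolution_congr _ (coeFn_reflect 1 (kern x)) (EventuallyEq.refl _ f),
      convolution_congr _ (EventuallyEq.refl _ _) (coeFn_reflect p f), convolution_def,
      convolution_def, ← integral_neg_eq_self]
    congr 1 with s
    simp only [neg_neg, ContinuousLinearMap.mul_apply']
    congr 2; ring
  rw [op_apply, op_apply, add_apply, add_apply, map_add, refl, coef_mk, kern_mk, h1, h2]

theorem op_mem_LpMinus {p : ℝ≥0∞} [Fact (1 ≤ p)] {x : Alg} (hx : refl x ∈ plus) {f : LpR p}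
    (hf : f ∈ LpMinus p) : op p x f ∈ LpMinus p := by
  have h := op_mem_LpPlus hx (mem_LpMinus_iff_reflect.1 hf)
  rwa [op_refl, reflect_reflect, ← mem_LpMinus_iff_reflect] at h

theorem mem_plus_ofG {a : G} : ofG a ∈ plus ↔ a.IsPlus := by
  rw [mem_plus, G.IsPlus, mem_LpPlus]
  refine and_congr Iff.rfl ⟨fun h => ?_, fun h => ?_⟩
  · filter_upwards [h, kern_ofG a] with s h1 h2 hs
    rw [← h2, h1 hs]
  · filter_upwards [h, kern_ofG a] with s h1 h2 hs
    rw [h2, h1 hs]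

theorem refl_mem_plus_iff {x : Alg} :
    refl x ∈ plus ↔ (∀ δ > 0, coef x δ = 0) ∧ kern x ∈ LpMinus 1 := by
  rw [mem_plus, refl, coef_mk, kern_mk, mem_LpMinus_iff_reflect]
  refine and_congr ⟨fun h δ hδ => ?_, fun h δ hδ => ?_⟩ Iff.rfl
  · rw [← h (-δ) (by linarith), reflCoef_apply, neg_neg]
  · rw [reflCoef_apply, h (-δ) (by linarith)]

theorem refl_mem_plus_ofG {a : G} : refl (ofG a) ∈ plus ↔ a.IsMinus := by
  rw [refl_mem_plus_iff, G.IsMinus, mem_LpMinus]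
  refine and_congr Iff.rfl ⟨fun h => ?_, fun h => ?_⟩
  · filter_upwards [h, kern_ofG a] with s h1 h2 hs
    rw [← h2, h1 hs]
  · filter_upwards [h, kern_ofG a] with s h1 h2 hs
    rw [h2, h1 hs]

theorem eq_smul_one_of_plus_of_minus {x : Alg} (h1 : x ∈ plus) (h2 : refl x ∈ plus) :
    x = coef x 0 • (1 : Alg) := by
  rw [refl_mem_plus_iff] at h2
  refine ext ?_ ?_
  · ext δ
    rw [map_smul, coef_one, lp.coeFn_smul, Pi.smul_apply, Coef.delta_apply]
    rcases lt_trichotomy δ 0 with h | h | h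
    · simp [h.ne, h1.1 δ h]
    · subst h; simp
    · simp [h.ne', h2.1 δ h]
  · rw [map_smul, kern_one, smul_zero, Lp.eq_zero_iff_ae_eq_zero]
    exact ae_of_ae_lt_of_ae_gt (mem_LpPlus.1 h1.2) (mem_LpMinus.1 h2.2)

theorem exists_plus_add_minus (x : Alg) : ∃ y z : Alg, y ∈ plus ∧ refl z ∈ plus ∧ x = y + z := by
  have hs : Summable fun δ => ‖(Set.Ici (0 : ℝ)).indicator (coef x) δ‖ := by
    refine (Coef.summable_norm (coef x)).of_nonneg_of_le (fun _ => norm_nonneg _) fun δ => ?_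
    exact norm_indicator_le_norm_self _ _
  set y := mk (Coef.of _ hs) (projP 1 (kern x)) with hy
  refine ⟨y, x - y, ?_, ?_, by abel⟩
  · refine mem_plus.2 ⟨fun δ hδ => ?_, projP_mem 1 _⟩
    rw [hy, coef_mk, Coef.of_apply, Set.indicator_of_notMem (by simpa using hδ)]
  · rw [refl_mem_plus_iff]
    refine ⟨fun δ hδ => ?_, ?_⟩
    · rw [map_sub, lp.coeFn_sub, Pi.sub_apply, hy, coef_mk, Coef.of_apply,
        Set.indicator_of_mem (Set.mem_Ici.2 hδ.le), sub_self]
    · rw [map_sub, hy, kern_mk, ← projP_eq_zero_iff, map_sub, projP_of_mem (projP_mem 1 _),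
        sub_self]

end Alg

end

noncomputable section

open Filter Topology

/-! ### The element `χ` and the kernel of a Wiener-Hopf operator -/

theorem coeFn_psi0 (p : ℝ≥0∞) [Fact (1 ≤ p)] : (psi0 p : LpR p) =ᵐ[volume]
    (Set.Ioi (0 : ℝ)).indicator fun t : ℝ => Complex.exp (-(t : ℂ)) :=
  MemLp.coeFn_toLp (memLp_expDecay p)

theorem psi0_ne_zero (p : ℝ≥0∞) [Fact (1 ≤ p)] : (psi0 p : LpR p) ≠ 0 := by
  rw [Ne, Lp.eq_zero_iff_ae_eq_zero]
  intro h
  have h2 : ∀ᵐ t : ℝ, t ∉ Set.Ioi (0 : ℝ) := by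
    filter_upwards [h, coeFn_psi0 p] with t h1 h2 ht
    rw [h1, Set.indicator_of_mem ht] at h2
    exact Complex.exp_ne_zero _ h2.symm
  rw [ae_iff] at h2
  simp only [not_not, Set.ofPred_mem_eq, Real.volume_Ioi, ENNReal.top_ne_zero] at h2

namespace Alg

/-- The element representing `χ(t) = (t - i) / (t + i) = 1 - 2 ∫_0^∞ e^{-s} e^{its} ds`. Its
reflection represents `1 / χ`. -/
def chi : Alg := 1 - (2 : ℂ) • mk 0 (psi0 1)

theorem add_I_ne_zero (t : ℝ) : (t : ℂ) + Complex.I ≠ 0 := fun h => by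
  simpa using congrArg Complex.im h

theorem sub_I_ne_zero (t : ℝ) : (t : ℂ) - Complex.I ≠ 0 := fun h => by
  simpa using congrArg Complex.im h

theorem evKern_psi0 (t : ℝ) : evKern t (psi0 1) = 1 / (1 - Complex.I * t) := by
  have h2 : evKern t (psi0 1) = ∫ s : ℝ in Set.Ioi 0, Complex.exp ((Complex.I * t - 1) * s) := by
    rw [evKern_apply, ← integral_indicator measurableSet_Ioi]
    refine integral_congr_ae ?_
    filter_upwards [coeFn_psi0 1] with s hs
    rw [hs]
    by_cases h : s ∈ Set.Ioi (0 : ℝ)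
    · rw [Set.indicator_of_mem h, Set.indicator_of_mem h, ← Complex.exp_add]
      congr 1; ring
    · rw [Set.indicator_of_notMem h, Set.indicator_of_notMem h, zero_mul]
  rw [h2, integral_exp_mul_complex_Ioi (by simp)]
  rw [Complex.ofReal_zero, mul_zero, Complex.exp_zero, ← neg_sub 1 (Complex.I * (t : ℂ)),
    div_neg, neg_div, neg_neg]

theorem ev_chi (t : ℝ) : ev t chi = WienerHopf.chi t := by
  have h3 : (1 : ℂ) - Complex.I * t ≠ 0 := fun h => by simpa using congrArg Complex.re h
  rw [chi, map_sub, map_smul, ev_one, ev_apply, coef_mk, kern_mk, map_zero, zero_add,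
    evKern_psi0, WienerHopf.chi, smul_eq_mul, eq_div_iff (add_I_ne_zero t)]
  field_simp
  linear_combination (-2 * (t : ℂ)) * Complex.I_sq

theorem chi_neg (t : ℝ) : WienerHopf.chi (-t) = (WienerHopf.chi t)⁻¹ := by
  rw [WienerHopf.chi, WienerHopf.chi, inv_div]
  have h1 := add_I_ne_zero t
  have h2 := sub_I_ne_zero t
  rw [div_eq_div_iff _ h2]
  · push_cast; ring
  · have := add_I_ne_zero (-t)
    exact this

theorem chi_ne_zero (t : ℝ) : WienerHopf.chi t ≠ 0 :=
  div_ne_zero (sub_I_ne_zero t) (add_I_ne_zero t)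

theorem ev_refl_chi (t : ℝ) : ev t (refl chi) = (WienerHopf.chi t)⁻¹ := by
  rw [ev_refl, ev_chi, chi_neg]

theorem chi_mul_refl_chi : chi * refl chi = 1 := ev_injective fun t => by
  rw [ev_mul, ev_chi, ev_refl_chi, ev_one, mul_inv_cancel₀ (chi_ne_zero t)]

variable {p : ℝ≥0∞} [Fact (1 ≤ p)]

/-- The convolution of `e^s` on the negative with `e^{-s}` on the positive semi-axis is
`e^{-|t|} / 2`. -/
theorem two_smul_convL_reflect_psi0 :
    (2 : ℂ) • convL p (reflect 1 (psi0 1)) (psi0 p) = psi0 p + reflect p (psi0 p) := by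
  refine Lp.ext ?_
  filter_upwards [Lp.coeFn_smul (2 : ℂ) (convL p (reflect 1 (psi0 1)) (psi0 p)),
    coeFn_convL p (reflect 1 (psi0 1)) (psi0 p), coeFn_psi0 p, ae_comp_neg (coeFn_psi0 p),
    Lp.coeFn_add (psi0 p : LpR p) (reflect p (psi0 p)), coeFn_reflect p (psi0 p : LpR p),
    Measure.ae_ne volume (0 : ℝ)] with t h1 h2 h3 h4 h5 h6 ht0
  have hk : reflect 1 (psi0 1) =ᵐ[volume]
      fun s : ℝ => (Set.Ioi (0 : ℝ)).indicator (fun t : ℝ => Complex.exp (-(t : ℂ))) (-s) := by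
    filter_upwards [coeFn_reflect 1 (psi0 1 : LpR 1), ae_comp_neg (coeFn_psi0 1)] with s hs1 hs2
    rw [hs1, hs2]
  have hconv : convolution (reflect 1 (psi0 1)) (psi0 p) (ContinuousLinearMap.mul ℂ ℂ) volume t
      = Complex.exp (-(t : ℂ)) * ∫ s : ℝ in Set.Iio (min 0 t), Complex.exp (2 * (s : ℂ)) := by
    rw [convolution_congr _ hk (coeFn_psi0 p), convolution_def, ← integral_const_mul,
      ← integral_indicator measurableSet_Iio]
    congr 1 with s
    rw [ContinuousLinearMap.mul_apply']
    by_cases h : s < min 0 t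
    · rw [lt_min_iff] at h
      rw [Set.indicator_of_mem (show -s ∈ Set.Ioi (0 : ℝ) by simpa using h.1),
        Set.indicator_of_mem (show t - s ∈ Set.Ioi (0 : ℝ) by simpa using h.2),
        Set.indicator_of_mem (show s ∈ Set.Iio (min 0 t) by simpa using h),
        ← Complex.exp_add, ← Complex.exp_add]
      congr 1; push_cast; ring
    · rw [Set.indicator_of_notMem (show s ∉ Set.Iio (min 0 t) by simpa using h)]
      rw [lt_min_iff, not_and_or] at h
      rcases h with h | h
      · rw [Set.indicator_of_notMem (show -s ∉ Set.Ioi (0 : ℝ) by simpa using h), zero_mul]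
      · rw [Set.indicator_of_notMem (show t - s ∉ Set.Ioi (0 : ℝ) by simpa using h), mul_zero]
  rw [h1, Pi.smul_apply, h2, h5, Pi.add_apply, h6, h3, h4, hconv, smul_eq_mul,
    ← integral_Iic_eq_integral_Iio, integral_exp_mul_complex_Iic (by simp)]
  rcases lt_or_gt_of_ne ht0 with h | h
  · rw [min_eq_right h.le, Set.indicator_of_notMem (by simpa using h.le),
      Set.indicator_of_mem (by simpa using h), zero_add, mul_left_comm,
      mul_div_cancel₀ _ two_ne_zero,
      ← Complex.exp_add]
    congr 1; push_cast; ring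
  · rw [min_eq_left h.le, Set.indicator_of_mem (by simpa using h),
      Set.indicator_of_notMem (by simpa using h.le)]
    simp
    ring

theorem op_mk_zero (k : LpR 1) : op p (mk 0 k) = convL p k := by
  rw [op_apply, coef_mk, kern_mk, map_zero, zero_add]

theorem refl_chi : refl chi = 1 - (2 : ℂ) • mk 0 (reflect 1 (psi0 1)) := by
  refine ext ?_ ?_
  · simp [refl, chi, reflCoef]
  · simp [refl, chi]

theorem op_refl_chi_psi0 : op p (refl chi) (psi0 p) = - reflect p (psi0 p) := by
  rw [refl_chi, map_sub, map_smul, sub_apply, smul_apply, op_mk_zero, op_one_apply,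
    two_smul_convL_reflect_psi0]
  abel

/-- `W⁰(χ)` sends functions on the negative semi-axis to functions that are proportional to `ψ₀` on
the positive semi-axis. -/
theorem exists_projP_op_chi {w : LpR p} (hw : w ∈ LpMinus p) :
    ∃ c : ℂ, projP p (op p chi w) = c • (psi0 p : LpR p) := by
  set K : ℂ := ∫ r : ℝ, Complex.exp r * w r with hK
  have hconv : ∀ t : ℝ, 0 < t →
      convolution (psi0 1) w (ContinuousLinearMap.mul ℂ ℂ) volume t =
        Complex.exp (-(t : ℂ)) * K := by
    intro t ht
    rw [convolution_congr _ (coeFn_psi0 1) (EventuallyEq.refl _ w), convolution_def, hK,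
      ← integral_const_mul, ← integral_sub_left_eq_self _ volume t]
    refine integral_congr_ae (ae_of_ae_lt_of_ae_gt (.of_forall fun r hr => ?_) ?_)
    · simp only [ContinuousLinearMap.mul_apply', sub_sub_cancel]
      rw [Set.indicator_of_mem (show t - r ∈ Set.Ioi (0 : ℝ) from sub_pos.2 (hr.trans ht)),
        ← mul_assoc, ← Complex.exp_add]
      congr 2; push_cast; ring
    · filter_upwards [mem_LpMinus.1 hw] with r hr hr0
      simp [hr hr0]
  refine ⟨-2 * K, ?_⟩
  have hop : op p chi w = w - (2 : ℂ) • convL p (psi0 1) w := by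
    rw [chi, map_sub, map_smul, sub_apply, smul_apply, op_mk_zero, op_one_apply]
  refine Lp.ext (ae_of_ae_lt_of_ae_gt ?_ ?_)
  · filter_upwards [mem_LpPlus.1 (projP_mem p (op p chi w)),
      mem_LpPlus.1 ((LpPlus p).smul_mem (-2 * K) (psi0 p).2)] with t h1 h2 ht
    rw [h1 ht, h2 ht]
  · filter_upwards [coeFn_projP p (op p chi w), Lp.coeFn_smul (-2 * K) (psi0 p : LpR p),
      coeFn_psi0 p, coeFn_convL p (psi0 1) w, mem_LpMinus.1 hw,
      Lp.coeFn_sub w ((2 : ℂ) • convL p (psi0 1) w),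
      Lp.coeFn_smul (2 : ℂ) (convL p (psi0 1) w)] with t h1 h2 h3 h4 h5 h6 h7 ht
    rw [h1, Set.indicator_of_mem (Set.mem_Ioi.2 ht), h2, Pi.smul_apply, h3,
      Set.indicator_of_mem (Set.mem_Ioi.2 ht), hop, h6, Pi.sub_apply, h5 ht, h7, Pi.smul_apply,
      h4, hconv t ht]
    simp only [smul_eq_mul]; ring

section Factorization

variable {x m mi q qi : Alg}

/-- A solution `f ∈ L^p(ℝ⁺)` of `P W⁰(x) f = 0`, where `x = m χ⁻¹ q` with a one-sided invertible `m`
on the negative side and `q` on the positive side: `W⁰(q) f` solves the same equation for `χ⁻¹`,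
so that it is a multiple of `ψ₀`. -/
theorem exists_eq_smul_of_op_mem_LpMinus (hmi : refl mi ∈ plus) (hm : m * mi = 1) (hq : q ∈ plus)
    (hqi : q * qi = 1) (hx : x = m * refl chi * q) {f : LpR p} (hf : f ∈ LpPlus p)
    (h : op p x f ∈ LpMinus p) : ∃ c : ℂ, f = c • op p qi (psi0 p) := by
  have h1 : op p (refl chi) (op p q f) ∈ LpMinus p := by
    have := op_mem_LpMinus hmi h
    rwa [← op_mul_apply, show mi * x = refl chi * q by
      rw [hx, mul_assoc, ← mul_assoc, mul_comm mi, hm, one_mul], op_mul_apply] at this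
  obtain ⟨c, hc⟩ := exists_projP_op_chi h1
  rw [← op_mul_apply, chi_mul_refl_chi, op_one_apply, projP_of_mem (op_mem_LpPlus hq hf)] at hc
  refine ⟨c, ?_⟩
  rw [← map_smul, ← hc, ← op_mul_apply, mul_comm, hqi, op_one_apply]

theorem op_op_psi0 (hqi : q * qi = 1) (hx : x = m * refl chi * q) :
    op p x (op p qi (psi0 p)) = -op p m (reflect p (psi0 p)) := by
  rw [← op_mul_apply, hx, mul_assoc, hqi, mul_one, op_mul_apply, op_refl_chi_psi0, map_neg]

/-- If `x(t) x(-t) = 1`, then `q(t) m(-t)` belongs to both one-sided subalgebras, hence it is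
constant. -/
theorem refl_eq_smul (hm : refl m ∈ plus) (hmi : refl mi ∈ plus) (hmm : m * mi = 1)
    (hq : q ∈ plus) (hqi : qi ∈ plus) (hqq : q * qi = 1)
    (hx : x = m * refl chi * q) (hxx : x * refl x = 1) : refl m = (-ev 0 x) • qi := by
  have hqqr : refl q * refl qi = 1 := by rw [← refl_mul, hqq, refl_one]
  have h2 : q * refl m = mi * refl qi := by
    have h3 : x * refl x = (m * refl q) * (q * refl m) := by
      rw [hx, refl_mul, refl_mul, refl_refl]
      linear_combination (m * q * refl m * refl q) * chi_mul_refl_chi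
    linear_combination (q * refl m) * (-hmm - m * mi * hqqr) + mi * refl qi * (hxx - h3)
  have h3 : q * refl m = coef (q * refl m) 0 • (1 : Alg) := by
    refine eq_smul_one_of_plus_of_minus (plus.mul_mem hq hm) ?_
    rw [h2, refl_mul, refl_refl]
    exact plus.mul_mem hmi hqi
  have h4 : coef (q * refl m) 0 = -ev 0 x := by
    have h5 := congrArg (ev 0) h3
    rw [map_smul, ev_one, smul_eq_mul, mul_one] at h5
    rw [← h5, hx, ev_mul, ev_mul, ev_mul, ev_refl_chi, ev_refl, WienerHopf.chi]
    simp
    ring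
  rw [← h4, ← mul_one qi, ← mul_smul_comm, ← h3, ← mul_assoc, mul_comm qi, hqq, one_mul]

end Factorization

end Alg

/-- The conclusion on `ker W(g)` and the projections, for a given factorization. -/
theorem kernel_of_factorization (p : ℝ≥0∞) [Fact (1 ≤ p)] {g gm gmInv gp gpInv : G}
    (hg : ∀ t : ℝ, g t * g (-t) = 1) (hF : IsFactorization g 0 (-1) gm gmInv gp gpInv) :
    Module.finrank ℂ (kerW p g) = 1 ∧
      kerW p g = Submodule.span ℂ {W p gpInv (psi0 p)} ∧
      LinearMap.range (boldPPlus p g) =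
        Submodule.span ℂ {((1 - xi g (-1)) / 2) • W p gpInv (psi0 p)} ∧
      LinearMap.range (boldPMinus p g) =
        Submodule.span ℂ {((1 + xi g (-1)) / 2) • W p gpInv (psi0 p)} := by
  have hm := Alg.refl_mem_plus_ofG.2 hF.minus
  have hmi := Alg.refl_mem_plus_ofG.2 hF.minus_inv
  have hq := Alg.mem_plus_ofG.2 hF.plus
  have hqi := Alg.mem_plus_ofG.2 hF.plus_inv
  have hmm : Alg.ofG gm * Alg.ofG gmInv = 1 := Alg.ev_injective fun t => by
    rw [Alg.ev_mul, Alg.ev_ofG, Alg.ev_ofG, hF.minus_mul_inv, Alg.ev_one]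
  have hqq : Alg.ofG gp * Alg.ofG gpInv = 1 := Alg.ev_injective fun t => by
    rw [Alg.ev_mul, Alg.ev_ofG, Alg.ev_ofG, hF.plus_mul_inv, Alg.ev_one]
  have hxx : Alg.ofG g * Alg.refl (Alg.ofG g) = 1 := Alg.ev_injective fun t => by
    rw [Alg.ev_mul, Alg.ev_refl, Alg.ev_ofG, Alg.ev_ofG, hg, Alg.ev_one]
  have hx : Alg.ofG g = Alg.ofG gm * Alg.refl Alg.chi * Alg.ofG gp := Alg.ev_injective fun t => by
    rw [Alg.ev_mul, Alg.ev_mul, Alg.ev_ofG, Alg.ev_ofG, Alg.ev_ofG, Alg.ev_refl_chi, hF.eq]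
    simp
  have hxi : xi g (-1) = -Alg.ev 0 (Alg.ofG g) := by rw [xi, Alg.ev_ofG]; simp
  set f₀ : LpR p := Alg.op p (Alg.ofG gpInv) (psi0 p) with hf₀
  have hf₀mem : f₀ ∈ LpPlus p := Alg.op_mem_LpPlus hqi (psi0 p).2
  have hW : ∀ (a : G) (f : LpPlus p), (W p a f : LpR p) = projP p (Alg.op p (Alg.ofG a) f) := by
    intro a f; rw [Alg.op_ofG]; rfl
  have hWf₀ : (W p gpInv (psi0 p) : LpR p) = f₀ := by rw [hW, projP_of_mem hf₀mem]
  set e := W p gpInv (psi0 p) with he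
  have hf₀ne : e ≠ 0 := by
    intro h0
    refine psi0_ne_zero p ?_
    have h2 : Alg.op p (Alg.ofG gp) f₀ = psi0 p := by
      rw [hf₀, ← Alg.op_mul_apply, hqq, Alg.op_one_apply]
    rw [← h2, ← hWf₀, h0, ZeroMemClass.coe_zero, map_zero]
  have hmem : ∀ f : LpPlus p, f ∈ kerW p g ↔ Alg.op p (Alg.ofG g) f ∈ LpMinus p := by
    intro f
    rw [← projP_eq_zero_iff, ← hW, ZeroMemClass.coe_eq_zero]
    rfl
  have hop : Alg.op p (Alg.ofG g) e = -Alg.op p (Alg.ofG gm) (reflect p (psi0 p)) := by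
    rw [hWf₀]; exact Alg.op_op_psi0 hqq hx
  have hopmem : Alg.op p (Alg.ofG g) e ∈ LpMinus p := by
    rw [hop]
    exact neg_mem (Alg.op_mem_LpMinus hm (reflect_mem_LpMinus.2 (psi0 p).2))
  have hker : kerW p g = Submodule.span ℂ {e} := by
    ext f
    rw [Submodule.mem_span_singleton, hmem]
    constructor
    · intro h
      obtain ⟨c, hc⟩ := Alg.exists_eq_smul_of_op_mem_LpMinus hmi hmm hq hqq hx f.2 h
      exact ⟨c, Subtype.ext (by rw [hc, Submodule.coe_smul, hWf₀])⟩
    · rintro ⟨c, rfl⟩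
      rw [Submodule.coe_smul, map_smul]
      exact (LpMinus p).smul_mem _ hopmem
  have heker : e ∈ kerW p g := (hmem e).2 hopmem
  have hJ : JQWP p g e = -(xi g (-1) • e) := by
    refine Subtype.ext ?_
    have h1 : (JQWP p g e : LpR p) = reflect p (projQ p (Alg.op p (Alg.ofG g) (projP p e))) := by
      rw [Alg.op_ofG]; rfl
    rw [h1, projP_of_mem e.2, projQ_of_mem hopmem, hop, map_neg, ← Alg.op_refl,
      Alg.refl_eq_smul hm hmi hmm hq hqi hqq hx hxx, map_smul, smul_apply, hxi]
    rw [NegMemClass.coe_neg, Submodule.coe_smul, hWf₀]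
  have hrange : ∀ (T : kerW p g →ₗ[ℂ] LpPlus p) (v : LpPlus p), T ⟨e, heker⟩ = v →
      LinearMap.range T = Submodule.span ℂ {v} := by
    intro T v hT
    ext y
    rw [LinearMap.mem_range, Submodule.mem_span_singleton]
    constructor
    · rintro ⟨⟨f, hf⟩, rfl⟩
      obtain ⟨c, rfl⟩ := Submodule.mem_span_singleton.1 (hker ▸ hf)
      refine ⟨c, ?_⟩
      rw [← hT, ← map_smul]
      rfl
    · rintro ⟨c, rfl⟩
      exact ⟨c • ⟨e, heker⟩, by rw [map_smul, hT]⟩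
  refine ⟨?_, hker, hrange _ _ ?_, hrange _ _ ?_⟩
  · rw [hker, finrank_span_singleton hf₀ne]
  · change (1 / 2 : ℂ) • (e + JQWP p g e) = _
    rw [hJ]; module
  · change (1 / 2 : ℂ) • (e - JQWP p g e) = _
    rw [hJ]; module

end

noncomputable section

open Filter Topology

/-! ### Logarithms of almost periodic elements -/

/-- Finitely many real numbers have integer coordinates with respect to a suitable family of
additive functionals that separates the points of `ℝ` (multiples of the coordinates of a Hamel
basis), and only finitely many of the functionals are nonzero at them. -/
theorem exists_integer_coordinates (S : Finset ℝ) :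
    ∃ (ι : Type) (φ : ι → ℝ →+ ℝ) (J : Finset ι) (Γ : AddSubgroup ℝ),
      (∀ δ ∈ S, δ ∈ Γ) ∧ (∀ δ, (∀ i, φ i δ = 0) → δ = 0) ∧
      (∀ δ ∈ Γ, ∀ i ∉ J, φ i δ = 0) ∧ ∀ δ ∈ Γ, ∀ i, ∃ n : ℤ, φ i δ = n := by
  classical
  let B := Module.Basis.ofVectorSpace ℚ ℝ
  let J := S.biUnion fun δ => (B.repr δ).support
  -- a common denominator of the coordinates
  let N : ℕ := ∏ δ ∈ S, ∏ i ∈ J, (B.repr δ i).den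
  have hN : N ≠ 0 := Finset.prod_ne_zero_iff.2 fun δ _ => Finset.prod_ne_zero_iff.2 fun i _ =>
    (B.repr δ i).den_nz
  let φ : Module.Basis.ofVectorSpaceIndex ℚ ℝ → ℝ →+ ℝ := fun i =>
    { toFun := fun δ => ((N * B.repr δ i : ℚ) : ℝ)
      map_zero' := by simp
      map_add' := fun x y => by
        rw [map_add, Finsupp.add_apply, mul_add, Rat.cast_add] }
  have hφ : ∀ i δ, φ i δ = ((N * B.repr δ i : ℚ) : ℝ) := fun _ _ => rfl
  let Γ : AddSubgroup ℝ :=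
    { carrier := {δ | (∀ i ∉ J, φ i δ = 0) ∧ ∀ i, ∃ n : ℤ, φ i δ = n}
      zero_mem' := ⟨fun i _ => map_zero _, fun i => ⟨0, by simp⟩⟩
      add_mem' := fun {x y} hx hy => ⟨fun i hi => by rw [map_add, hx.1 i hi, hy.1 i hi, add_zero],
        fun i => by
          obtain ⟨n, hn⟩ := hx.2 i
          obtain ⟨m, hm⟩ := hy.2 i
          exact ⟨n + m, by rw [map_add, hn, hm]; push_cast; rfl⟩⟩
      neg_mem' := fun {x} hx => ⟨fun i hi => by rw [map_neg, hx.1 i hi, neg_zero],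
        fun i => by
          obtain ⟨n, hn⟩ := hx.2 i
          exact ⟨-n, by rw [map_neg, hn]; push_cast; rfl⟩⟩ }
  have hJ : ∀ δ ∈ S, ∀ i ∉ J, B.repr δ i = 0 := by
    intro δ hδ i hi
    by_contra h
    exact hi (Finset.mem_biUnion.2 ⟨δ, hδ, Finsupp.mem_support_iff.2 h⟩)
  refine ⟨_, φ, J, Γ, fun δ hδ => ⟨fun i hi => ?_, fun i => ?_⟩, fun δ h => ?_,
    fun δ hδ i hi => hδ.1 i hi, fun δ hδ i => hδ.2 i⟩
  · rw [hφ, hJ δ hδ i hi, mul_zero, Rat.cast_zero]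
  · by_cases hi : i ∈ J
    · have hd : (B.repr δ i).den ∣ N :=
        (Finset.dvd_prod_of_mem (fun i => (B.repr δ i).den) hi).trans
          (Finset.dvd_prod_of_mem (fun δ => ∏ i ∈ J, (B.repr δ i).den) hδ)
      obtain ⟨k, hk⟩ := hd
      refine ⟨k * (B.repr δ i).num, ?_⟩
      rw [hφ, hk]
      have : ((B.repr δ i).den : ℚ) * B.repr δ i = (B.repr δ i).num := Rat.den_mul_eq_num _
      rw [show (((B.repr δ i).den * k : ℕ) : ℚ) * B.repr δ i = ((k * (B.repr δ i).num : ℤ) : ℚ) by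
        push_cast; rw [← this]; ring]
      simp
    · exact ⟨0, by rw [hφ, hJ δ hδ i hi, mul_zero]; simp⟩
  · refine B.repr.map_eq_zero_iff.1 (Finsupp.ext fun i => ?_)
    have := h i
    rw [hφ, Rat.cast_eq_zero, mul_eq_zero] at this
    simpa [hN] using this

namespace Alg

/-- Elements near `1` have logarithms: the derivative of the exponential at `0` is the identity. -/
theorem eventually_exists_exp : ∀ᶠ x in 𝓝 (1 : Alg), ∃ y, NormedSpace.exp y = x := by
  have h := (hasStrictFDerivAt_exp_zero (𝕂 := ℂ) (𝔸 := Alg)).map_nhds_eq_of_equiv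
    (f' := ContinuousLinearEquiv.refl ℂ Alg)
  rw [NormedSpace.exp_zero] at h
  rw [← h, eventually_map]
  exact .of_forall fun y => ⟨y, rfl⟩

/-- The subalgebra of elements without kernel whose frequencies belong to `Γ`. -/
def apSub (Γ : AddSubgroup ℝ) : Subalgebra ℂ Alg where
  carrier := {x | (∀ δ ∉ Γ, coef x δ = 0) ∧ kern x = 0}
  mul_mem' := fun {x y} hx hy => by
    refine ⟨fun γ hγ => ?_, ?_⟩
    · rw [coef_mul]
      refine (Coef.hasSum_conv (coef x) (coef y) γ).unique ?_
      convert! hasSum_zero with δ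
      by_cases hδ : δ ∈ Γ
      · have : γ - δ ∉ Γ := fun h => hγ (by simpa using Γ.add_mem h hδ)
        simp [hy.1 (γ - δ) this]
      · simp [hx.1 δ hδ]
    · simp [hx.2, hy.2]
  add_mem' := fun {x y} hx hy => by
    refine ⟨fun γ hγ => ?_, ?_⟩
    · rw [map_add, lp.coeFn_add, Pi.add_apply, hx.1 γ hγ, hy.1 γ hγ, add_zero]
    · rw [map_add, hx.2, hy.2, add_zero]
  algebraMap_mem' := fun c => by
    rw [Algebra.algebraMap_eq_smul_one]
    refine ⟨fun γ hγ => ?_, ?_⟩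
    · have : γ ≠ 0 := fun h => hγ (h ▸ Γ.zero_mem)
      simp [Coef.delta_apply, this]
    · simp

theorem mem_apSub {Γ : AddSubgroup ℝ} {x : Alg} :
    x ∈ apSub Γ ↔ (∀ δ ∉ Γ, coef x δ = 0) ∧ kern x = 0 := Iff.rfl

theorem isClosed_apSub (Γ : AddSubgroup ℝ) : IsClosed (apSub Γ : Set Alg) := by
  have : (apSub Γ : Set Alg) = (⋂ δ ∈ (Γ : Set ℝ)ᶜ, {x | Coef.evalL δ (coef x) = 0}) ∩
      {x | kern x = 0} := by
    ext x
    simp [mem_apSub]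
  rw [this]
  refine IsClosed.inter (isClosed_biInter fun δ _ => ?_) ?_
  · exact isClosed_eq ((Coef.evalL δ).continuous.comp coef.continuous) continuous_const
  · exact isClosed_eq kern.continuous continuous_const

/-- `IsDer φ x y` says that `x` has no kernel and that `y` is its image under the derivation
`e^{iδt} ↦ φ(δ) e^{iδt}`, an unbounded operator. -/
structure IsDer (φ : ℝ →+ ℝ) (x y : Alg) : Prop where
  kern_left : kern x = 0
  kern_right : kern y = 0
  coef_eq : ∀ δ, coef y δ = φ δ * coef x δ

namespace IsDer

variable {φ : ℝ →+ ℝ} {x y x' y' : Alg}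

theorem unique (h : IsDer φ x y) (h' : IsDer φ x y') : y = y' := by
  refine ext ?_ (by rw [h.kern_right, h'.kern_right])
  ext δ
  rw [h.coef_eq, h'.coef_eq]

theorem one : IsDer φ 1 0 := by
  refine ⟨kern_one, map_zero _, fun δ => ?_⟩
  rw [coef_one, Coef.delta_apply]
  by_cases h : δ = 0 <;> simp [h]

theorem mul (h : IsDer φ x y) (h' : IsDer φ x' y') : IsDer φ (x * x') (x * y' + y * x') := by
  refine ⟨?_, ?_, fun γ => ?_⟩
  · simp [h.kern_left, h'.kern_left]
  · simp [h.kern_left, h'.kern_left, h.kern_right, h'.kern_right]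
  · rw [map_add, coef_mul, coef_mul, coef_mul, lp.coeFn_add, Pi.add_apply]
    have h1 := (Coef.hasSum_conv (coef x) (coef y') γ).add (Coef.hasSum_conv (coef y) (coef x') γ)
    refine h1.unique ?_
    convert! (Coef.hasSum_conv (coef x) (coef x') γ).mul_left (φ γ : ℂ) using 2 with δ
    rw [h.coef_eq, h'.coef_eq, map_sub]
    push_cast; ring

theorem neg (h : IsDer φ x y) : IsDer φ (-x) (-y) := by
  refine ⟨by rw [map_neg, h.kern_left, neg_zero], by rw [map_neg, h.kern_right, neg_zero],
    fun δ => ?_⟩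
  rw [map_neg, map_neg, lp.coeFn_neg, lp.coeFn_neg, Pi.neg_apply, Pi.neg_apply, h.coef_eq, mul_neg]

theorem smul (c : ℂ) (h : IsDer φ x y) : IsDer φ (c • x) (c • y) := by
  refine ⟨by rw [map_smul, h.kern_left, smul_zero], by rw [map_smul, h.kern_right, smul_zero],
    fun δ => ?_⟩
  rw [map_smul, map_smul, lp.coeFn_smul, lp.coeFn_smul, Pi.smul_apply, Pi.smul_apply, h.coef_eq,
    smul_eq_mul, smul_eq_mul, mul_left_comm]

theorem add (h : IsDer φ x y) (h' : IsDer φ x' y') : IsDer φ (x + x') (y + y') := by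
  refine ⟨by rw [map_add, h.kern_left, h'.kern_left, add_zero],
    by rw [map_add, h.kern_right, h'.kern_right, add_zero], fun δ => ?_⟩
  rw [map_add, map_add, lp.coeFn_add, lp.coeFn_add, Pi.add_apply, Pi.add_apply, h.coef_eq,
    h'.coef_eq, mul_add]

theorem pow (h : IsDer φ x y) (n : ℕ) : IsDer φ (x ^ n) (n * x ^ (n - 1) * y) := by
  induction n with
  | zero => simpa using one
  | succ n ih =>
    rw [pow_succ]
    convert! ih.mul h using 1
    rcases n with _ | n
    · simp
    · push_cast
      ring

theorem hasSum {f f' : ℕ → Alg} {F F' : Alg} (h : ∀ n, IsDer φ (f n) (f' n)) (hf : HasSum f F)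
    (hf' : HasSum f' F') : IsDer φ F F' := by
  refine ⟨?_, ?_, fun δ => ?_⟩
  · refine (kern.hasSum hf).unique ?_
    simp only [(h _).kern_left]
    exact hasSum_zero
  · refine (kern.hasSum hf').unique ?_
    simp only [(h _).kern_right]
    exact hasSum_zero
  · have h1 := (Coef.evalL δ ∘L coef).hasSum hf
    have h2 := (Coef.evalL δ ∘L coef).hasSum hf'
    refine h2.unique ?_
    convert! h1.mul_left (φ δ : ℂ) using 2 with n
    exact (h n).coef_eq δ

theorem exp (h : IsDer φ x y) : IsDer φ (NormedSpace.exp x) (NormedSpace.exp x * y) := by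
  refine hasSum (fun n => (h.pow n).smul ((n.factorial : ℂ)⁻¹))
    (NormedSpace.exp_series_hasSum_exp' (𝕂 := ℂ) x) ?_
  rw [← hasSum_nat_add_iff' 1]
  simp only [Finset.range_one, Finset.sum_singleton, Nat.cast_zero, zero_mul, smul_zero, sub_zero,
    add_tsub_cancel_right]
  convert! (NormedSpace.exp_series_hasSum_exp' (𝕂 := ℂ) x).mul_right y using 2 with n
  have h1 : ((n + 1 : ℕ) : Alg) = ((n + 1 : ℕ) : ℂ) • (1 : Alg) := by
    rw [← map_natCast (algebraMap ℂ Alg), Algebra.algebraMap_eq_smul_one]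
  rw [h1, Nat.factorial_succ, smul_mul_assoc, smul_mul_assoc, one_mul, smul_smul, smul_mul_assoc]
  congr 1
  have : ((n + 1 : ℕ) : ℂ) ≠ 0 := Nat.cast_ne_zero.2 n.succ_ne_zero
  push_cast at this ⊢
  field_simp

/-- The Neumann series of a differentiable element is differentiable. -/
theorem exists_tsum_pow (h : IsDer φ x y) (hx : ‖x‖ < 1) : ∃ z, IsDer φ (∑' n : ℕ, x ^ n) z := by
  have hs : Summable fun n : ℕ => x ^ n := summable_geometric_of_norm_lt_one hx
  have hs' : Summable fun n : ℕ => (n : Alg) * x ^ (n - 1) * y := by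
    rw [← summable_nat_add_iff 1]
    refine Summable.mul_right y ?_
    have h1 := (summable_norm_pow_mul_geometric_of_norm_lt_one 1 hx).of_norm
    have h0 := h1.add hs
    refine h0.congr fun n => ?_
    push_cast
    ring
  exact ⟨_, hasSum h.pow hs.hasSum hs'.hasSum⟩

end IsDer

end Alg

end

noncomputable section

open Filter Topology

/-! ### Almost periodic elements: the logarithm up to a character -/

namespace Alg

/-- The element with coefficients `a` and without kernel. -/
def ap : Coef →L[ℂ] Alg :=
  LinearMap.mkContinuous
    { toFun := fun a => mk a 0
      map_add' := fun a b => ext (by simp) (by simp)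
      map_smul' := fun c a => ext (by simp) (by simp) }
    1 (fun a => by
      change ‖mk a 0‖ ≤ _
      rw [norm_eq, coef_mk, kern_mk, norm_zero, add_zero, one_mul])

@[simp] theorem coef_ap (a : Coef) : coef (ap a) = a := rfl

@[simp] theorem kern_ap (a : Coef) : kern (ap a) = 0 := rfl

theorem ap_conv (a b : Coef) : ap (Coef.conv a b) = ap a * ap b :=
  ext rfl (by simp)

theorem ap_delta_zero : ap (Coef.delta 0) = 1 := rfl

theorem ev_ap (t : ℝ) (a : Coef) : ev t (ap a) = evCoef t a := by
  rw [ev_apply, coef_ap, kern_ap, map_zero, add_zero]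

/-- A trigonometric polynomial is differentiable for every derivation. -/
theorem exists_isDer_of_finite (φ : ℝ →+ ℝ) {S : Finset ℝ} {x : Alg} (hx : ∀ δ ∉ S, coef x δ = 0)
    (hk : kern x = 0) : ∃ y, IsDer φ x y ∧ ∀ δ ∉ S, coef y δ = 0 := by
  have hs : Summable fun δ => ‖(φ δ : ℂ) * coef x δ‖ :=
    summable_of_ne_finset_zero (s := S) fun δ hδ => by rw [hx δ hδ, mul_zero, norm_zero]
  refine ⟨mk (Coef.of _ hs) 0, ⟨hk, rfl, fun δ => rfl⟩, fun δ hδ => ?_⟩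
  rw [coef_mk, Coef.of_apply, hx δ hδ, mul_zero]

/-- A trigonometric polynomial `x` with an approximate inverse `x'` that is a trigonometric
polynomial has the form `C e^{iδ₀t} e^{c(t)}`. The logarithmic derivatives `d_j` of `x` along the
derivations given by integer coordinates of the frequencies are compatible, and they have a common
primitive `c` up to their means; division by the integer coordinates preserves summability. The
quotient `x e^{-c}` is an eigenvector of all the derivations, hence a multiple of one
exponential. -/
theorem exists_eq_smul_delta_mul_exp_of_finite {S : Finset ℝ} {x x' : Alg}
    (hx : ∀ δ ∉ S, coef x δ = 0) (hxk : kern x = 0) (hx' : ∀ δ ∉ S, coef x' δ = 0)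
    (hxk' : kern x' = 0) (hxx : ‖1 - x * x'‖ < 1) :
    ∃ (C : ℂ) (δ₀ : ℝ) (c : Alg), x = C • ap (Coef.delta δ₀) * NormedSpace.exp c := by
  obtain ⟨ι, φ, J, Γ, hSΓ, hsep, hJ, hint⟩ := exists_integer_coordinates S
  have hfin : ∀ {z : Alg}, (∀ δ ∉ S, coef z δ = 0) → kern z = 0 → z ∈ apSub Γ := fun hz hk =>
    ⟨fun δ hδ => hz δ fun h => hδ (hSΓ δ h), hk⟩
  -- the inverse `q` of `x`, given by a Neumann series
  set q := x' * ∑' n : ℕ, (1 - x * x') ^ n with hq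
  have hxq : x * q = 1 := by
    have := mul_neg_geom_series (1 - x * x') hxx
    rwa [sub_sub_cancel, mul_assoc] at this
  have hqΓ : q ∈ apSub Γ := by
    refine (apSub Γ).mul_mem (hfin hx' hxk') ((isClosed_apSub Γ).mem_of_tendsto
      (summable_geometric_of_norm_lt_one hxx).hasSum (.of_forall fun T => ?_))
    exact (apSub Γ).sum_mem fun n _ => (apSub Γ).pow_mem
      (sub_mem (one_mem _) ((apSub Γ).mul_mem (hfin hx hxk) (hfin hx' hxk'))) n
  choose y hy hyS using fun i => exists_isDer_of_finite (φ i) hx hxk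
  choose y' hy' _ using fun i => exists_isDer_of_finite (φ i) hx' hxk'
  choose y2 hy2 _ using fun i j => exists_isDer_of_finite (φ i) (hyS j) (hy j).kern_right
  have hy2symm : ∀ i j, y2 i j = y2 j i := fun i j =>
    ext (by ext δ; rw [(hy2 i j).coef_eq, (hy2 j i).coef_eq, (hy j).coef_eq, (hy i).coef_eq]; ring)
      (by rw [(hy2 i j).kern_right, (hy2 j i).kern_right])
  -- `q` is differentiable, because its Neumann series is
  have hqder : ∀ i, IsDer (φ i) q (-(q * q * y i)) := by
    intro i
    have h1 : IsDer (φ i) (1 - x * x') (0 + -(x * y' i + y i * x')) := by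
      rw [sub_eq_add_neg]
      exact IsDer.one.add ((hy i).mul (hy' i)).neg
    obtain ⟨z, hz⟩ := h1.exists_tsum_pow hxx
    have h2 := (hy' i).mul hz
    rw [← hq] at h2
    have h3 := (hy i).mul h2
    rw [hxq] at h3
    have h4 := h3.unique IsDer.one
    convert! h2 using 1
    linear_combination (-q) * h4 + (x' * z + y' i * ∑' n : ℕ, (1 - x * x') ^ n) * hxq
  -- the logarithmic derivatives of `x`
  set d : ι → Alg := fun i => y i * q with hd
  have hdΓ : ∀ i, d i ∈ apSub Γ := fun i =>
    (apSub Γ).mul_mem (hfin (hyS i) (hy i).kern_right) hqΓ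
  -- mixed second derivatives of `log x` agree, since those of `x` do
  have hsymm : ∀ i j δ, (φ i δ : ℂ) * coef (d j) δ = φ j δ * coef (d i) δ := by
    intro i j δ
    have h1 := (hy2 i j).mul (hqder i)
    have h2 := (hy2 j i).mul (hqder j)
    rw [← h1.coef_eq, ← h2.coef_eq, hy2symm]
    refine congrArg (fun z => coef z δ) ?_
    ring
  -- the denominators `∑_j φ_j²` of the coefficients of the primitive
  set T : ℝ → ℝ := fun δ => ∑ j ∈ J, φ j δ ^ 2 with hT
  -- `|n| ≤ n²` for integers: the coefficients of `c` are bounded by those of the `d_j`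
  have hTj : ∀ δ ∈ Γ, ∀ j ∈ J, |φ j δ| ≤ T δ := by
    intro δ hδ j hj
    have h1 : φ j δ ^ 2 ≤ T δ :=
      Finset.single_le_sum (f := fun j => φ j δ ^ 2) (fun i _ => sq_nonneg _) hj
    refine le_trans ?_ h1
    obtain ⟨n, hn⟩ := hint δ hδ j
    rw [hn, ← sq_abs (n : ℝ), ← Int.cast_abs]
    exact_mod_cast Int.le_self_sq |n|
  have hT0 : ∀ δ, 0 ≤ T δ := fun δ => Finset.sum_nonneg fun j _ => sq_nonneg _
  have hs : Summable fun δ => ‖(∑ j ∈ J, (φ j δ : ℂ) * coef (d j) δ) / (T δ : ℂ)‖ := by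
    refine Summable.of_nonneg_of_le (fun _ => norm_nonneg _) (fun δ => ?_)
      (summable_sum fun j (_ : j ∈ J) => Coef.summable_norm (coef (d j)))
    rw [norm_div, Complex.norm_real, Real.norm_eq_abs, abs_of_nonneg (hT0 δ)]
    by_cases hδ : δ ∈ Γ
    · refine div_le_of_le_mul₀ (hT0 δ) (Finset.sum_nonneg fun j _ => norm_nonneg _) ?_
      rw [Finset.sum_mul]
      refine (norm_sum_le _ _).trans (Finset.sum_le_sum fun j hj => ?_)
      rw [norm_mul, Complex.norm_real, Real.norm_eq_abs, mul_comm]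
      exact mul_le_mul_of_nonneg_left (hTj δ hδ j hj) (norm_nonneg _)
    · have : ∑ j ∈ J, (φ j δ : ℂ) * coef (d j) δ = 0 :=
        Finset.sum_eq_zero fun j _ => by rw [(hdΓ j).1 δ hδ, mul_zero]
      rw [this, norm_zero, zero_div]
      exact Finset.sum_nonneg fun j _ => norm_nonneg _
  set c : Alg := ap (Coef.of _ hs) with hc
  have hcder : ∀ i, IsDer (φ i) c (d i - coef (d i) 0 • (1 : Alg)) := by
    intro i
    refine ⟨rfl, by rw [map_sub, (hdΓ i).2, map_smul, kern_one, smul_zero, sub_zero], fun δ => ?_⟩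
    rw [hc, coef_ap, Coef.of_apply, map_sub, map_smul, coef_one, lp.coeFn_sub, Pi.sub_apply,
      lp.coeFn_smul, Pi.smul_apply, Coef.delta_apply]
    by_cases hδ0 : δ = 0
    · subst hδ0; simp
    rw [if_neg hδ0, smul_zero, sub_zero, ← mul_div_assoc]
    by_cases hδ : δ ∈ Γ
    · have hTne : T δ ≠ 0 := by
        intro h0
        refine hδ0 (hsep δ fun j => ?_)
        by_cases hj : j ∈ J
        · have := hTj δ hδ j hj
          rw [h0] at this
          exact abs_nonpos_iff.1 this
        · exact hJ δ hδ j hj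
      rw [eq_div_iff (Complex.ofReal_ne_zero.2 hTne), Finset.mul_sum, hT]
      push_cast
      rw [Finset.mul_sum]
      refine Finset.sum_congr rfl fun j _ => ?_
      linear_combination (-(φ j δ : ℂ)) * hsymm i j δ
    · rw [(hdΓ i).1 δ hδ, Finset.sum_eq_zero fun j _ => by rw [(hdΓ j).1 δ hδ, mul_zero], mul_zero,
        zero_div]
  -- `u = e^{-c} x` is a joint eigenvector of the derivations
  set u := NormedSpace.exp (-c) * x with hu
  have huder : ∀ i, IsDer (φ i) u (coef (d i) 0 • u) := by
    intro i
    convert! (hcder i).neg.exp.mul (hy i) using 1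
    rw [hu, hd]
    simp only [neg_sub, mul_sub, sub_mul, mul_smul_comm, mul_one, smul_mul_assoc]
    linear_combination (NormedSpace.exp (-c) * y i) * hxq
  have hexp : NormedSpace.exp c * NormedSpace.exp (-c) = 1 := by
    rw [← NormedSpace.exp_add, add_neg_cancel, NormedSpace.exp_zero]
  have hxu : x = u * NormedSpace.exp c := by
    rw [hu]; linear_combination (-x) * hexp
  rcases isEmpty_or_nonempty ι with hι | hι
  · have : (1 : ℝ) = 0 := hsep 1 fun i => hι.elim i
    norm_num at this
  have huk : kern u = 0 := (huder hι.some).kern_left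
  have hcu : coef u ≠ 0 := by
    intro h0
    have : u = 0 := ext (by rw [h0, map_zero]) (by rw [huk, map_zero])
    rw [hxu, this, zero_mul, zero_mul] at hxq
    simpa using congrArg norm hxq
  obtain ⟨δ₀, hδ₀⟩ : ∃ δ₀, coef u δ₀ ≠ 0 := by
    by_contra! h
    exact hcu (lp.ext (funext h))
  refine ⟨coef u δ₀, δ₀, c, ?_⟩
  rw [← show u = coef u δ₀ • ap (Coef.delta δ₀) from ext ?_ ?_]
  · exact hxu
  · ext δ
    rw [map_smul, coef_ap, lp.coeFn_smul, Pi.smul_apply, Coef.delta_apply]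
    by_cases hδ : δ = δ₀
    · subst hδ; simp
    · rw [if_neg hδ, smul_zero]
      by_contra hne
      refine hδ (sub_eq_zero.1 (hsep _ fun i => ?_))
      -- all frequencies of `u` have the same coordinates
      have heq : ∀ γ, coef u γ ≠ 0 → (φ i γ : ℂ) = coef (d i) 0 := fun γ hγ => by
        have := (huder i).coef_eq γ
        rw [map_smul, lp.coeFn_smul, Pi.smul_apply, smul_eq_mul] at this
        exact (mul_right_cancel₀ hγ this).symm
      have := (heq δ hne).trans (heq δ₀ hδ₀).symm
      rw [map_sub, sub_eq_zero]
      exact_mod_cast this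
  · rw [map_smul, kern_ap, smul_zero, huk]

/-- An invertible almost periodic element has the form `C e^{iδ₀t} e^{c(t)}`. -/
theorem exists_eq_smul_delta_mul_exp {a b : Coef} (hab : ap a * ap b = 1) :
    ∃ (C : ℂ) (δ₀ : ℝ) (c : Alg), ap a = C • ap (Coef.delta δ₀) * NormedSpace.exp c := by
  classical
  have hA : ∀ a : Coef, Tendsto (fun S : Finset ℝ => ap (∑ δ ∈ S, a δ • Coef.delta δ)) atTop
      (𝓝 (ap a)) := fun a => (ap.continuous.tendsto a).comp (Coef.hasSum_delta a)
  have h1 := ((hA a).mul_const (ap b))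
  have h2 := ((hA a).mul (hA b)).const_sub 1
  rw [hab] at h1 h2
  rw [sub_self] at h2
  obtain ⟨S, ⟨y, hy⟩, hS⟩ := ((h1.eventually eventually_exists_exp).and
    (h2.norm.eventually (gt_mem_nhds (by rw [norm_zero]; exact one_pos)))).exists
  have hfin : ∀ a : Coef, ∀ δ ∉ S, coef (ap (∑ δ ∈ S, a δ • Coef.delta δ)) δ = 0 := by
    intro a δ hδ
    rw [coef_ap, ← Coef.evalL_apply, map_sum]
    refine Finset.sum_eq_zero fun ε hε => ?_
    rw [map_smul, Coef.evalL_apply, Coef.delta_apply, if_neg (fun h : δ = ε => hδ (h ▸ hε)),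
      smul_zero]
  obtain ⟨C, δ₀, c, hc⟩ :=
    exists_eq_smul_delta_mul_exp_of_finite (hfin a) rfl (hfin b) rfl hS
  refine ⟨C, δ₀, c + -y, ?_⟩
  have hexp : NormedSpace.exp y * NormedSpace.exp (-y) = 1 := by
    rw [← NormedSpace.exp_add, add_neg_cancel, NormedSpace.exp_zero]
  set s := ap (∑ δ ∈ S, a δ • Coef.delta δ)
  rw [NormedSpace.exp_add, ← mul_assoc, ← hc]
  linear_combination (s * NormedSpace.exp (-y)) * hab +
    (ap a * NormedSpace.exp (-y)) * (hy) - (ap a) * hexp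

end Alg

end

noncomputable section

open Filter Topology

/-! ### Logarithms in the Wiener algebra -/

/-- The Fourier integral of an integrable function vanishes at infinity. -/
theorem tendsto_evKern (k : LpR 1) : Tendsto (fun t => evKern t k) (cocompact ℝ) (𝓝 0) := by
  have h := Real.tendsto_integral_exp_smul_cocompact (fun s => k s)
  have h2 : Tendsto (fun t : ℝ => -(2 * Real.pi)⁻¹ * t) (cocompact ℝ) (cocompact ℝ) :=
    (Homeomorph.mulLeft₀ (-(2 * Real.pi)⁻¹)
      (neg_ne_zero.2 (inv_ne_zero (by positivity)))).isClosedEmbedding.tendsto_cocompact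
  refine (h.comp h2).congr fun t => ?_
  rw [evKern_apply, Function.comp_apply]
  congr 1 with s
  rw [Circle.smul_def, Real.fourierChar_apply, smul_eq_mul, mul_comm]
  congr 2
  push_cast
  have : (Real.pi : ℂ) ≠ 0 := Complex.ofReal_ne_zero.2 Real.pi_ne_zero
  field_simp

theorem hasDerivAt_fourier_integral {k : ℝ → ℂ} (hk : Integrable k)
    (hk' : Integrable fun s : ℝ => (s : ℂ) * k s) (t : ℝ) :
    HasDerivAt (fun t : ℝ => ∫ s : ℝ, k s * Complex.exp (Complex.I * t * s))
      (Complex.I * ∫ s : ℝ, (s : ℂ) * k s * Complex.exp (Complex.I * t * s)) t := by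
  have h := hasDerivAt_integral_of_dominated_loc_of_deriv_le (μ := volume) (𝕜 := ℝ)
    (F := fun (t s : ℝ) => k s * Complex.exp (Complex.I * t * s))
    (F' := fun (t s : ℝ) => Complex.I * ((s : ℂ) * k s * Complex.exp (Complex.I * t * s)))
    (x₀ := t) (s := Set.univ) (bound := fun s : ℝ => ‖(s : ℂ) * k s‖) univ_mem
    (.of_forall fun t => (integrable_mul_exp hk t).1) (integrable_mul_exp hk t)
    ((integrable_mul_exp hk' t).1.const_mul _)
    (.of_forall fun s t _ => by rw [norm_mul, norm_mul, Complex.norm_I, one_mul, norm_exp_I_mul,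
      mul_one])
    hk'.norm
    (.of_forall fun s t _ => by
      have h1 : HasDerivAt (fun t : ℝ => Complex.I * (t : ℂ) * s) (Complex.I * 1 * s) t :=
        ((hasDerivAt_id t).ofReal_comp.const_mul Complex.I).mul_const (s : ℂ)
      convert! h1.cexp.const_mul (k s) using 1
      ring)
  convert! h.2 using 1
  rw [integral_const_mul]

theorem chi_eq_neg_exp_arctan (t : ℝ) :
    chi t = -Complex.exp (2 * Complex.I * Real.arctan t) := by
  have hs : (Real.sqrt (1 + t ^ 2)) ^ 2 = 1 + t ^ 2 := Real.sq_sqrt (by positivity)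
  have hs0 : (Real.sqrt (1 + t ^ 2) : ℂ) ≠ 0 :=
    Complex.ofReal_ne_zero.2 (Real.sqrt_ne_zero'.2 (by positivity))
  have hsc : (Real.sqrt (1 + t ^ 2) : ℂ) ^ 2 = 1 + (t : ℂ) ^ 2 := by exact_mod_cast hs
  rw [show 2 * Complex.I * (Real.arctan t : ℂ) =
        ((2 : ℕ) : ℂ) * ((Real.arctan t : ℂ) * Complex.I) by
    push_cast; ring, Complex.exp_nat_mul, Complex.exp_mul_I, ← Complex.ofReal_cos,
    ← Complex.ofReal_sin, Real.cos_arctan, Real.sin_arctan, chi, div_eq_iff (Alg.add_I_ne_zero t)]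
  push_cast
  field_simp
  rw [hsc]
  linear_combination (2 * (t : ℂ) + Complex.I * (t ^ 2) + t ^ 3) * Complex.I_sq

namespace Alg

/-- The element with kernel `k` and without coefficients. -/
def ofKern : LpR 1 →L[ℂ] Alg :=
  LinearMap.mkContinuous
    { toFun := fun k => mk 0 k
      map_add' := fun a b => ext (by simp) (by simp)
      map_smul' := fun c a => ext (by simp) (by simp) }
    1 (fun a => by
      change ‖mk 0 a‖ ≤ _
      rw [norm_eq, coef_mk, kern_mk, norm_zero, zero_add, one_mul])

@[simp] theorem coef_ofKern (k : LpR 1) : coef (ofKern k) = 0 := rfl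

@[simp] theorem kern_ofKern (k : LpR 1) : kern (ofKern k) = k := rfl

theorem ev_ofKern (t : ℝ) (k : LpR 1) : ev t (ofKern k) = evKern t k := by
  rw [ev_apply, coef_ofKern, kern_ofKern, map_zero, zero_add]

theorem ap_coef_mul (x y : Alg) : ap (coef (x * y)) = ap (coef x) * ap (coef y) := by
  rw [coef_mul, ap_conv]

theorem kern_mul_ofKern (x : Alg) (k : LpR 1) (hx : coef x = Coef.delta 0) :
    kern (x * ofKern k) = k + convL 1 (kern x) k := by
  have h : apOp 1 (Coef.delta 0) k = k := by
    have := op_one_apply 1 k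
    rwa [op_apply, coef_one, kern_one, map_zero, add_zero] at this
  rw [kern_mul, kern_ofKern, coef_ofKern, hx, h, map_zero, zero_apply, add_zero]

end Alg

/-- A Lipschitz condition at the origin makes `(d(s) - d(0) e^{-|s|}) / s` integrable. -/
theorem integrable_sub_exp_div {d : ℝ → ℂ} (hd : Integrable d) {K : ℝ}
    (hK : ∀ s, ‖d s - d 0‖ ≤ K * |s|) (he : Integrable fun s : ℝ => Complex.exp (-(|s| : ℝ))) :
    Integrable fun s : ℝ => (d s - d 0 * Complex.exp (-(|s| : ℝ))) / s := by
  have hbound : Integrable fun s : ℝ => (Set.Icc (-1 : ℝ) 1).indicator (fun _ => K + ‖d 0‖) s +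
      (‖d s‖ + ‖d 0‖ * ‖Complex.exp (-(|s| : ℝ))‖) := by
    refine Integrable.add ?_ (hd.norm.add (he.norm.const_mul _))
    exact (integrable_indicator_iff measurableSet_Icc).2 (by simp)
  refine hbound.mono' ?_ (.of_forall fun s => ?_)
  · exact ((hd.1.sub (he.1.const_mul _)).aemeasurable.div
      Complex.measurable_ofReal.aemeasurable).aestronglyMeasurable
  have hK0 : 0 ≤ K := by simpa using (norm_nonneg _).trans (hK 1)
  rw [norm_div, Complex.norm_real, Real.norm_eq_abs]
  by_cases hs : s ∈ Set.Icc (-1 : ℝ) 1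
  · rw [Set.indicator_of_mem hs]
    refine le_trans ?_ (le_add_of_nonneg_right (by positivity))
    refine div_le_of_le_mul₀ (abs_nonneg s) (by positivity) ?_
    have h1 : ‖(1 : ℂ) - Complex.exp (-(|s| : ℝ))‖ ≤ |s| := by
      rw [← Complex.ofReal_neg, ← Complex.ofReal_exp, ← Complex.ofReal_one, ← Complex.ofReal_sub,
        Complex.norm_real, Real.norm_eq_abs, abs_of_nonneg
          (sub_nonneg.2 (Real.exp_le_one_iff.2 (neg_nonpos.2 (abs_nonneg s))))]
      have := Real.add_one_le_exp (-|s|)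
      linarith
    calc ‖d s - d 0 * Complex.exp (-(|s| : ℝ))‖
        = ‖(d s - d 0) + d 0 * (1 - Complex.exp (-(|s| : ℝ)))‖ := by congr 1; ring
      _ ≤ ‖d s - d 0‖ + ‖d 0‖ * ‖1 - Complex.exp (-(|s| : ℝ))‖ := by
        rw [← norm_mul]; exact norm_add_le _ _
      _ ≤ K * |s| + ‖d 0‖ * |s| := add_le_add (hK s) (by gcongr)
      _ = (K + ‖d 0‖) * |s| := by ring
  · rw [Set.indicator_of_notMem hs, zero_add]
    have h1 : 1 ≤ |s| := by
      rw [Set.mem_Icc, ← abs_le, not_le] at hs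
      exact hs.le
    refine (div_le_self (norm_nonneg _) h1).trans ((norm_sub_le _ _).trans ?_)
    rw [norm_mul]

theorem add_reflect_psi0_ae : ((psi0 1 : LpR 1) + reflect 1 (psi0 1) : LpR 1) =ᵐ[volume]
    fun s : ℝ => Complex.exp (-(|s| : ℝ)) := by
  filter_upwards [Lp.coeFn_add (psi0 1 : LpR 1) (reflect 1 (psi0 1)),
    coeFn_psi0 1, coeFn_reflect 1 (psi0 1 : LpR 1), ae_comp_neg (coeFn_psi0 1),
    Measure.ae_ne volume (0 : ℝ)] with s h1 h2 h3 h4 h5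
  rw [h1, Pi.add_apply, h2, h3, h4]
  rcases lt_or_gt_of_ne h5 with h | h
  · rw [Set.indicator_of_notMem (by simpa using h.le), Set.indicator_of_mem (by simpa using h),
      abs_of_neg h, zero_add]
  · rw [Set.indicator_of_mem (by simpa using h), Set.indicator_of_notMem (by simpa using h.le),
      abs_of_pos h, add_zero]

theorem integral_exp_neg_abs (t : ℝ) :
    ∫ s : ℝ, Complex.exp (-(|s| : ℝ)) * Complex.exp (Complex.I * t * s) =
      2 / (1 + (t : ℂ) ^ 2) := by
  have h1 : evKern t ((psi0 1 : LpR 1) + reflect 1 (psi0 1)) = 2 / (1 + (t : ℂ) ^ 2) := by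
    have h := Alg.ev_refl t (Alg.ofKern (psi0 1))
    rw [Alg.ev_ofKern, Alg.evKern_psi0, Alg.refl, Alg.coef_ofKern, Alg.kern_ofKern, map_zero] at h
    change Alg.ev t (Alg.ofKern (reflect 1 (psi0 1))) = _ at h
    rw [Alg.ev_ofKern] at h
    rw [map_add, Alg.evKern_psi0, h]
    have h3 : (1 : ℂ) - Complex.I * t ≠ 0 := fun h => by simpa using congrArg Complex.re h
    have h4 : (1 : ℂ) + Complex.I * t ≠ 0 := fun h => by simpa using congrArg Complex.re h
    have h5 : (1 : ℂ) + (t : ℂ) ^ 2 = (1 - Complex.I * t) * (1 + Complex.I * t) := by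
      linear_combination ((t : ℂ) ^ 2) * Complex.I_sq
    have h6 : (1 : ℂ) - Complex.I * ((-t : ℝ) : ℂ) = 1 + Complex.I * t := by push_cast; ring
    rw [h5, h6]
    field_simp
    ring
  rw [← h1, evKern_apply]
  refine integral_congr_ae ?_
  filter_upwards [add_reflect_psi0_ae] with s hs
  rw [hs]

end

noncomputable section

open Filter Topology

open scoped SchwartzMap

/-! ### The Wiener algebra: the logarithm up to a power of `χ` -/

theorem SchwartzMap.exists_lipschitz (m : 𝓢(ℝ, ℂ)) :
    ∃ L : ℝ, 0 ≤ L ∧ ∀ s r : ℝ, ‖m s - m r‖ ≤ L * |s - r| := by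
  refine ⟨SchwartzMap.seminorm ℝ 0 0 (SchwartzMap.derivCLM ℝ ℂ m), apply_nonneg _ _,
    fun s r => ?_⟩
  have h := Convex.norm_image_sub_le_of_norm_deriv_le (f := m) (s := Set.univ)
    (C := SchwartzMap.seminorm ℝ 0 0 (SchwartzMap.derivCLM ℝ ℂ m))
    (fun x _ => m.differentiableAt) (fun x _ => ?_) convex_univ (Set.mem_univ r) (Set.mem_univ s)
  · rwa [Real.norm_eq_abs] at h
  · rw [← SchwartzMap.derivCLM_apply ℝ]
    exact SchwartzMap.norm_le_seminorm ℝ _ x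

/-- The kernel `m + q * m` of a logarithmic derivative satisfies a Lipschitz condition if `m`
does. -/
theorem exists_lipschitz_add_convolution {q : ℝ → ℂ} (hq : Integrable q) (m : 𝓢(ℝ, ℂ)) :
    ∃ K : ℝ, ∀ s : ℝ, ‖(m s + convolution q m (ContinuousLinearMap.mul ℂ ℂ) volume s) -
      (m 0 + convolution q m (ContinuousLinearMap.mul ℂ ℂ) volume 0)‖ ≤ K * |s| := by
  obtain ⟨L, hL0, hL⟩ := SchwartzMap.exists_lipschitz m
  have hint : ∀ s : ℝ, Integrable fun r => q r * m (s - r) := fun s =>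
    hq.mul_bdd (c := SchwartzMap.seminorm ℝ 0 0 m)
      (m.continuous.comp (by fun_prop)).aestronglyMeasurable
      (.of_forall fun r => SchwartzMap.norm_le_seminorm ℝ m _)
  refine ⟨L + (∫ r, ‖q r‖) * L, fun s => ?_⟩
  have h1 : ‖convolution q m (ContinuousLinearMap.mul ℂ ℂ) volume s -
      convolution q m (ContinuousLinearMap.mul ℂ ℂ) volume 0‖ ≤ (∫ r, ‖q r‖) * (L * |s|) := by
    simp only [convolution_def, ContinuousLinearMap.mul_apply']
    rw [← integral_sub (hint s) (hint 0), ← integral_mul_const]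
    refine norm_integral_le_of_norm_le (hq.norm.mul_const _) (.of_forall fun r => ?_)
    rw [← mul_sub, norm_mul]
    refine mul_le_mul_of_nonneg_left ((hL _ _).trans ?_) (norm_nonneg _)
    rw [sub_sub_sub_cancel_right, sub_zero]
  rw [add_sub_add_comm]
  refine (norm_add_le _ _).trans ((add_le_add (hL s 0) h1).trans (le_of_eq ?_))
  rw [sub_zero]; ring

/-- If `U' = i M`, `U V = 1` and `c' = i (M V - 2κ / (1 + t²))`, and `U → 1`, `c → 0` at infinity,
then `U e^{-c} e^{-2iκ arctan}` is constant. Comparison of its limits at `±∞` shows that `κ` is an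
integer, and `U = χ^κ e^c`. -/
theorem exists_eq_chi_zpow_mul_exp {U V M c : ℝ → ℂ} {κ : ℂ} (hUV : ∀ t, U t * V t = 1)
    (hU : ∀ t, HasDerivAt U (Complex.I * M t) t)
    (hc : ∀ t : ℝ, HasDerivAt c (Complex.I * (M t * V t - κ * (2 / (1 + (t : ℂ) ^ 2)))) t)
    (hU1 : Tendsto U (cocompact ℝ) (𝓝 1)) (hc0 : Tendsto c (cocompact ℝ) (𝓝 0)) :
    ∃ n : ℤ, ∀ t, U t = chi t ^ n * Complex.exp (c t) := by
  set w : ℝ → ℂ := fun t => -c t - 2 * Complex.I * κ * Real.arctan t with hw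
  set h : ℝ → ℂ := fun t => U t * Complex.exp (w t) with hh
  have hderiv : ∀ t, HasDerivAt h 0 t := by
    intro t
    have h1 : HasDerivAt (fun t : ℝ => ((Real.arctan t : ℝ) : ℂ)) (1 / (1 + t ^ 2) : ℝ) t :=
      (Real.hasDerivAt_arctan t).ofReal_comp
    have h2 := ((hc t).neg.sub (h1.const_mul (2 * Complex.I * κ))).cexp
    have h3 := (hU t).mul h2
    convert! h3 using 1
    simp only [Pi.neg_apply, Pi.sub_apply, Complex.ofReal_div, Complex.ofReal_one,
      Complex.ofReal_add, Complex.ofReal_pow]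
    linear_combination (Complex.I * M t * Complex.exp (-c t - 2 * Complex.I * κ * Real.arctan t)) *
      hUV t
  have hconst : ∀ t, h t = h 0 := fun t =>
    is_const_of_deriv_eq_zero (fun t => (hderiv t).differentiableAt) (fun t => (hderiv t).deriv) t 0
  have hlim : ∀ {F : Filter ℝ} (hF : F ≤ cocompact ℝ) {θ : ℝ} [NeBot F],
      Tendsto Real.arctan F (𝓝 θ) → h 0 = Complex.exp (-(2 * Complex.I * κ * θ)) := by
    intro F hF θ _ hθ
    have h1 : Tendsto h F (𝓝 (1 * Complex.exp (-0 - 2 * Complex.I * κ * θ))) := by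
      refine (hU1.mono_left hF).mul (Complex.continuous_exp.continuousAt.tendsto.comp ?_)
      exact (hc0.mono_left hF).neg.sub
        (((Complex.continuous_ofReal.tendsto θ).comp hθ).const_mul _)
    rw [funext hconst] at h1
    rw [tendsto_nhds_unique tendsto_const_nhds h1]
    simp
  have htop := hlim atTop_le_cocompact
    (Real.tendsto_arctan_atTop.mono_right nhdsWithin_le_nhds)
  have hbot := hlim atBot_le_cocompact
    (Real.tendsto_arctan_atBot.mono_right nhdsWithin_le_nhds)
  -- the limits at `±∞` of the constant `h` are `e^{∓iπκ}`
  obtain ⟨n, hn⟩ : ∃ n : ℤ, κ = n := by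
    have h1 : Complex.exp (2 * Real.pi * Complex.I * κ) = 1 := by
      have h2 : Complex.exp (2 * Real.pi * Complex.I * κ) =
          Complex.exp (-(2 * Complex.I * κ * (-(Real.pi / 2) : ℝ))) /
            Complex.exp (-(2 * Complex.I * κ * (Real.pi / 2 : ℝ))) := by
        rw [← Complex.exp_sub]
        congr 1; push_cast; ring
      rw [h2, ← htop, ← hbot, div_self]
      rw [htop]
      exact Complex.exp_ne_zero _
    obtain ⟨n, hn⟩ := Complex.exp_eq_one_iff.1 h1
    refine ⟨n, ?_⟩
    have : (2 * Real.pi * Complex.I : ℂ) ≠ 0 := Complex.two_pi_I_ne_zero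
    exact mul_left_cancel₀ this (hn.trans (mul_comm _ _))
  refine ⟨n, fun t => ?_⟩
  have h1 : U t = h t * Complex.exp (-w t) := by
    rw [hh]
    simp only
    rw [mul_assoc, ← Complex.exp_add, add_neg_cancel, Complex.exp_zero, mul_one]
  have h2 : chi t = Complex.exp (2 * Complex.I * Real.arctan t - Real.pi * Complex.I) := by
    rw [Complex.exp_sub, Complex.exp_pi_mul_I, chi_eq_neg_exp_arctan, div_neg, div_one]
  rw [h1, hconst, htop, h2, ← Complex.exp_int_mul, ← Complex.exp_add, ← Complex.exp_add, hw, hn]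
  congr 1
  push_cast
  ring

namespace Alg

theorem ev_ofKern_congr {k : LpR 1} {f : ℝ → ℂ} (h : k =ᵐ[volume] f) (t : ℝ) :
    ev t (ofKern k) = ∫ s : ℝ, f s * Complex.exp (Complex.I * t * s) := by
  rw [ev_ofKern, evKern_apply]
  refine integral_congr_ae ?_
  filter_upwards [h] with s hs
  rw [hs]

theorem tendsto_ev_ofKern (k : LpR 1) :
    Tendsto (fun t => ev t (ofKern k)) (cocompact ℝ) (𝓝 0) := by
  simpa only [ev_ofKern] using tendsto_evKern k

theorem tendsto_ev_one_add_ofKern (k : LpR 1) :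
    Tendsto (fun t => ev t (1 + ofKern k)) (cocompact ℝ) (𝓝 1) := by
  simpa using (tendsto_ev_ofKern k).const_add 1

/-- The logarithm for the elements `1 + l` with a Schwartz kernel `l`: the logarithmic derivative
has an integrable kernel `d` that is Lipschitz, so that `(d(s) - d(0) e^{-|s|}) / s` is
integrable. -/
theorem exists_eq_chi_zpow_mul_exp_of_schwartz (l : 𝓢(ℝ, ℂ)) {v : Alg}
    (huv : (1 + ofKern (l.toLp 1)) * v = 1) :
    ∃ (n : ℤ) (c : Alg), ∀ t, ev t (1 + ofKern (l.toLp 1)) = WienerHopf.chi t ^ n *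
      Complex.exp (ev t c) := by
  set u : Alg := 1 + ofKern (l.toLp 1) with hu
  have hcu : ap (coef u) = 1 := by
    rw [hu, map_add, coef_one, coef_ofKern, add_zero, ap_delta_zero]
  have hcv : coef v = Coef.delta 0 := by
    have h := ap_coef_mul u v
    rw [huv, hcu, one_mul, coef_one] at h
    have := congrArg coef h
    rwa [coef_ap, coef_ap, eq_comm] at this
  have htg : (fun s : ℝ => (s : ℂ)).HasTemperateGrowth := Complex.ofRealCLM.hasTemperateGrowth
  -- the kernels `s l(s)` of the derivative and `d` of the logarithmic derivative (up to `i`)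
  set m : 𝓢(ℝ, ℂ) := SchwartzMap.smulLeftCLM ℂ (fun s : ℝ => (s : ℂ)) l with hm
  have hml : ∀ s : ℝ, m s = s * l s := fun s => by
    rw [hm, SchwartzMap.smulLeftCLM_apply_apply htg, smul_eq_mul]
  set D : Alg := v * ofKern (m.toLp 1) with hD
  set d : ℝ → ℂ := fun s => m s +
    convolution (kern v) m (ContinuousLinearMap.mul ℂ ℂ) volume s with hd
  have hDd : kern D =ᵐ[volume] d := by
    rw [hD, kern_mul_ofKern v _ hcv]
    filter_upwards [Lp.coeFn_add (m.toLp 1 volume) (convL 1 (kern v) (m.toLp 1)),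
      m.coeFn_toLp 1 volume, coeFn_convL 1 (kern v) (m.toLp 1)] with s h1 h2 h3
    rw [h1, Pi.add_apply, h2, h3,
      convolution_congr _ (EventuallyEq.refl _ _) (m.coeFn_toLp 1 volume)]
  have hcD : coef D = 0 := by rw [hD, coef_mul, coef_ofKern, map_zero]
  obtain ⟨K, hK⟩ := exists_lipschitz_add_convolution (integrable_L1 (kern v)) m
  have hdint : Integrable d := (integrable_congr hDd).1 (integrable_L1 _)
  have heint : Integrable fun s : ℝ => Complex.exp (-(|s| : ℝ)) :=
    (integrable_congr add_reflect_psi0_ae).1 (integrable_L1 _)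
  have hcint := integrable_sub_exp_div hdint hK heint
  -- the kernel of the logarithm; the subtracted term has the transform `2 d(0) / (1 + t²)`
  set k : ℝ → ℂ := fun s => (d s - d 0 * Complex.exp (-(|s| : ℝ))) / s with hk
  have hsk : (fun s : ℝ => (s : ℂ) * k s) =ᵐ[volume]
      fun s => d s - d 0 * Complex.exp (-(|s| : ℝ)) := by
    filter_upwards [Measure.ae_ne volume (0 : ℝ)] with s hs
    exact mul_div_cancel₀ _ (Complex.ofReal_ne_zero.2 hs)
  have hskint : Integrable fun s : ℝ => (s : ℂ) * k s :=
    (integrable_congr hsk).2 (hdint.sub (heint.const_mul _))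
  set c : Alg := ofKern (hcint.toL1 k) with hc
  have hevc : ∀ t : ℝ, ev t c = ∫ s : ℝ, k s * Complex.exp (Complex.I * t * s) :=
    ev_ofKern_congr hcint.coeFn_toL1
  have hevS : ∀ (f : 𝓢(ℝ, ℂ)) (t : ℝ), ev t (ofKern (f.toLp 1)) =
      ∫ s : ℝ, f s * Complex.exp (Complex.I * t * s) := fun f =>
    ev_ofKern_congr (f.coeFn_toLp 1 volume)
  have hevD : ∀ t : ℝ, ∫ s : ℝ, d s * Complex.exp (Complex.I * t * s) =
      ev t (ofKern (m.toLp 1)) * ev t v := by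
    intro t
    rw [mul_comm (ev t _), ← ev_mul, ← hD, ← ev_ofKern_congr hDd, ev_ofKern, ev_apply, hcD,
      map_zero, zero_add]
  have hlog : ∃ n : ℤ, ∀ t, ev t u = WienerHopf.chi t ^ n * Complex.exp (ev t c) := by
    refine exists_eq_chi_zpow_mul_exp (U := fun t : ℝ => ev t u) (V := fun t : ℝ => ev t v)
      (M := fun t : ℝ => ev t (ofKern (m.toLp 1)))
      (c := fun t : ℝ => ev t c) (κ := d 0)
      (fun t => by rw [← ev_mul, huv, ev_one]) (fun t => ?_) (fun t => ?_) ?_ ?_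
    · simp only [hu, map_add, ev_one, hevS, hml]
      refine (hasDerivAt_fourier_integral l.integrable ?_ t).const_add 1
      simpa only [← hml] using m.integrable
    · simp only [hevc]
      convert! hasDerivAt_fourier_integral hcint hskint t using 2
      rw [← hevD, ← integral_exp_neg_abs, ← integral_const_mul, ← integral_sub]
      · refine integral_congr_ae ?_
        filter_upwards [hsk] with s hs
        rw [hs]; ring
      · exact integrable_mul_exp hdint t
      · exact (integrable_mul_exp heint t).const_mul _
    · exact tendsto_ev_one_add_ofKern _
    · exact tendsto_ev_ofKern _
  obtain ⟨n, hn⟩ := hlog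
  exact ⟨n, c, hn⟩

/-- An invertible element `1 + l` has the form `χⁿ e^c`. -/
theorem exists_eq_chi_zpow_mul_exp_of_kern {k : LpR 1} {v : Alg} (huv : (1 + ofKern k) * v = 1) :
    ∃ (n : ℤ) (c : Alg), ∀ t, ev t (1 + ofKern k) = WienerHopf.chi t ^ n *
      Complex.exp (ev t c) := by
  have hcont : Tendsto (fun l : LpR 1 => (1 + ofKern l) * v) (𝓝 k) (𝓝 1) := by
    have h := ((ofKern.continuous.tendsto k).const_add 1).mul_const v
    rwa [huv] at h
  have hrange : DenseRange (SchwartzMap.toLpCLM ℝ ℂ 1 (volume : Measure ℝ)) :=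
    SchwartzMap.denseRange_toLpCLM ENNReal.one_ne_top
  have hdense := mem_closure_iff_frequently.1 (hrange k)
  obtain ⟨_, ⟨l, rfl⟩, y, hy⟩ :=
    (hdense.and_eventually (hcont.eventually eventually_exists_exp)).exists
  rw [SchwartzMap.toLpCLM_apply] at hy
  have hexp : NormedSpace.exp y * NormedSpace.exp (-y) = 1 := by
    rw [← NormedSpace.exp_add, add_neg_cancel, NormedSpace.exp_zero]
  obtain ⟨n, c, h⟩ := exists_eq_chi_zpow_mul_exp_of_schwartz l
    (v := v * NormedSpace.exp (-y)) (by rw [← mul_assoc, ← hy, hexp])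
  refine ⟨n, c + -y, fun t => ?_⟩
  have h1 : (1 + ofKern k) = (1 + ofKern (l.toLp 1)) * NormedSpace.exp (-y) := by
    linear_combination ((1 + ofKern (l.toLp 1 volume)) * NormedSpace.exp (-y)) * huv -
      (1 + ofKern k) * hexp + ((1 + ofKern k) * NormedSpace.exp (-y)) * hy
  rw [h1, ev_mul, ev_exp, h, map_add, Complex.exp_add, mul_assoc]

end Alg

end

noncomputable section

open Filter Topology

/-! ### Logarithms of invertible elements and the factorization -/

/-- A continuous argument is unique up to an additive constant. -/
theorem IsArg.exists_eq_add_const {f : ℝ → ℂ} {θ θ' : ℝ → ℝ} (hθ : IsArg f θ) (hθ' : Continuous θ')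
    {r : ℝ → ℝ} (hr : ∀ t, 0 < r t) (h : ∀ t, f t = r t * Complex.exp (Complex.I * θ' t)) :
    ∃ C : ℝ, ∀ t, θ t = θ' t + C := by
  have hexp : ∀ t, Circle.exp (θ t) = Circle.exp (θ' t) := by
    intro t
    have hn : ‖f t‖ = r t := by
      rw [h t, norm_mul, mul_comm Complex.I, Complex.norm_exp_ofReal_mul_I, mul_one,
        Complex.norm_real, Real.norm_eq_abs, abs_of_pos (hr t)]
    have h1 := hθ.2 t
    rw [hn, h t] at h1
    have h2 := mul_left_cancel₀ (Complex.ofReal_ne_zero.2 (hr t).ne') h1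
    refine Circle.ext ?_
    rw [Circle.coe_exp, Circle.coe_exp, mul_comm, ← h2, mul_comm]
  refine ⟨θ 0 - θ' 0, fun t => ?_⟩
  have h1 := Circle.isCoveringMap_exp.eq_of_comp_eq (g₁ := θ)
    (g₂ := fun t => θ' t + (θ 0 - θ' 0)) hθ.1 (hθ'.add continuous_const)
    (by
      ext1 t
      rw [Function.comp_apply, Function.comp_apply, Circle.exp_add, Circle.exp_sub, hexp 0,
        div_self',
        mul_one, hexp])
    0 (by ring)
  exact congrFun h1 t

theorem continuous_evCoef (a : Coef) : Continuous fun t => evCoef t a := by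
  simp only [evCoef_apply]
  refine continuous_tsum (fun δ => by fun_prop) (Coef.summable_norm a) fun δ t => ?_
  rw [norm_mul, norm_exp_I_mul, mul_one]

theorem continuous_evKern (k : LpR 1) : Continuous fun t => evKern t k := by
  simp only [evKern_apply]
  refine continuous_of_dominated (bound := fun s => ‖k s‖)
    (fun t => (integrable_mul_exp (integrable_L1 k) t).1) (fun t => .of_forall fun s => ?_)
    (integrable_L1 k).norm (.of_forall fun s => by fun_prop)
  rw [norm_mul, norm_exp_I_mul, mul_one]

theorem chi_eq_exp (t : ℝ) :
    chi t = Complex.exp (Complex.I * ((2 * Real.arctan t - Real.pi : ℝ) : ℂ)) := by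
  rw [chi_eq_neg_exp_arctan, ← mul_neg_one, ← Complex.exp_neg_pi_mul_I, ← Complex.exp_add]
  congr 1; push_cast; ring

namespace Alg

theorem continuous_ev (x : Alg) : Continuous fun t => ev t x :=
  (continuous_evCoef _).add (continuous_evKern _)

theorem norm_ev_le (t : ℝ) (x : Alg) : ‖ev t x‖ ≤ ‖x‖ := by
  rw [norm_eq, ev_apply]
  exact (norm_add_le _ _).trans (add_le_add (norm_evCoef_apply_le _ _) (norm_evKern_apply_le _ _))

/-- The value at `t` of the almost periodic part, a character that annihilates the kernels. -/
def apHom (t : ℝ) : Alg →ₐ[ℂ] ℂ :=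
  AlgHom.ofLinearMap (evCoef t ∘L coef) (by simp [evCoef_delta]) fun x y => evCoef_conv t _ _

theorem apHom_apply (t : ℝ) (x : Alg) : apHom t x = evCoef t (coef x) := rfl

/-- `χ` as an invertible element. -/
def chiUnit : Algˣ := ⟨chi, refl chi, chi_mul_refl_chi, by rw [mul_comm, chi_mul_refl_chi]⟩

theorem ev_chiUnit_zpow (t : ℝ) (n : ℤ) :
    ev t ((chiUnit ^ n : Algˣ) : Alg) = WienerHopf.chi t ^ n := by
  have h := congrArg (Units.val) (map_zpow (Units.map (evHom t : Alg →* ℂ)) chiUnit n)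
  rw [Units.val_zpow_eq_zpow_val] at h
  refine h.trans ?_
  rw [← ev_chi]; rfl

theorem apHom_chiUnit_zpow (t : ℝ) (n : ℤ) : apHom t ((chiUnit ^ n : Algˣ) : Alg) = 1 := by
  have h := congrArg (Units.val) (map_zpow (Units.map (apHom t : Alg →* ℂ)) chiUnit n)
  rw [Units.val_zpow_eq_zpow_val] at h
  refine h.trans ?_
  have h1 : ((Units.map (apHom t : Alg →* ℂ) chiUnit : ℂˣ) : ℂ) = 1 := by
    change apHom t chi = 1
    simp [apHom_apply, chi, evCoef_delta]
  rw [h1, one_zpow]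

/-- The exponent in `1 + l = χⁿ e^c` can be chosen without coefficients: the almost periodic part of
`e^c` is `1`. -/
theorem exists_eq_chi_zpow_mul_exp_evKern {k : LpR 1} {v : Alg} (huv : (1 + ofKern k) * v = 1) :
    ∃ (n : ℤ) (l : LpR 1), ∀ t, ev t (1 + ofKern k) = WienerHopf.chi t ^ n *
      Complex.exp (evKern t l) := by
  obtain ⟨n, c, h⟩ := exists_eq_chi_zpow_mul_exp_of_kern huv
  refine ⟨n, kern c, fun t => ?_⟩
  have h1 : 1 + ofKern k = ((chiUnit ^ n : Algˣ) : Alg) * NormedSpace.exp c :=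
    ev_injective fun t => by rw [h, ev_mul, ev_exp, ev_chiUnit_zpow]
  have h2 := congrArg (apHom t) h1
  have h3 : apHom t (NormedSpace.exp c) = Complex.exp (evCoef t (coef c)) := by
    rw [Complex.exp_eq_exp_ℂ]
    exact NormedSpace.map_exp (apHom t) (evCoef t ∘L coef).continuous c
  have h4 : apHom t (ofKern k) = 0 := by rw [apHom_apply, coef_ofKern, map_zero]
  rw [map_mul, apHom_chiUnit_zpow, one_mul, h3, map_add, map_one, h4, add_zero] at h2
  rw [h, ev_apply, Complex.exp_add, ← h2, one_mul]

theorem exp_smul_one (z : ℂ) : NormedSpace.exp (z • (1 : Alg)) = Complex.exp z • (1 : Alg) :=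
  ev_injective fun t => by rw [ev_exp, map_smul, map_smul, ev_one, smul_eq_mul, smul_eq_mul,
    mul_one, mul_one]

theorem refl_exp (x : Alg) : refl (NormedSpace.exp x) = NormedSpace.exp (refl x) :=
  ev_injective fun t => by rw [ev_refl, ev_exp, ev_exp, ev_refl]

end Alg

/-- An invertible almost periodic part of mean motion zero has a logarithm. -/
theorem exists_ap_eq_exp {g : G} {b : Coef} (hb : Alg.ap (Alg.coef (Alg.ofG g)) * Alg.ap b = 1)
    (hν : HasNu g 0) : ∃ c : Alg, Alg.ap (Alg.coef (Alg.ofG g)) = NormedSpace.exp c := by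
  obtain ⟨C, δ₀, c, hc⟩ := Alg.exists_eq_smul_delta_mul_exp hb
  have hC : C ≠ 0 := by
    rintro rfl
    rw [hc, zero_smul, zero_mul, zero_mul] at hb
    simpa using congrArg norm hb
  have hev : ∀ t : ℝ, g.apPart t =
      C * Complex.exp (Complex.I * δ₀ * t) * Complex.exp (Alg.ev t c) := by
    intro t
    rw [← Alg.evCoef_ofG, ← Alg.ev_ap, hc, Alg.ev_mul, Alg.ev_exp, map_smul, Alg.ev_ap,
      evCoef_delta, smul_eq_mul]
  obtain ⟨θ, hθ, hlim⟩ := hν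
  obtain ⟨A, hA⟩ := hθ.exists_eq_add_const
    (θ' := fun t => C.arg + δ₀ * t + (Alg.ev t c).im) (r := fun t => ‖C‖ * Real.exp (Alg.ev t c).re)
    ((by fun_prop : Continuous fun t : ℝ => C.arg + δ₀ * t).add
      (Complex.continuous_im.comp (Alg.continuous_ev c)))
    (fun t => by positivity) (fun t => by
      rw [hev]
      conv_lhs => rw [← Complex.norm_mul_exp_arg_mul_I C, ← Complex.re_add_im (Alg.ev t c)]
      push_cast
      rw [Complex.exp_add, show Complex.I * (C.arg + δ₀ * t + ((Alg.ev t c).im : ℂ)) =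
        C.arg * Complex.I + Complex.I * δ₀ * t + (Alg.ev t c).im * Complex.I by ring,
        Complex.exp_add, Complex.exp_add]
      ring)
  have hδ₀ : δ₀ = 0 := by
    refine tendsto_nhds_unique ?_ hlim
    have h1 : ∀ᶠ l : ℝ in atTop, δ₀ + ((Alg.ev l c).im - (Alg.ev (-l) c).im) * (2 * l)⁻¹ =
        (θ l - θ (-l)) / (2 * l) := by
      filter_upwards [eventually_gt_atTop 0] with l hl
      rw [hA, hA]
      field_simp
      ring
    refine Tendsto.congr' h1 ?_
    have h2 : Tendsto (fun l : ℝ => (2 * l)⁻¹) atTop (𝓝 0) :=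
      tendsto_inv_atTop_zero.comp (tendsto_id.const_mul_atTop two_pos)
    have h3 : Tendsto (fun l : ℝ => ((Alg.ev l c).im - (Alg.ev (-l) c).im) * (2 * l)⁻¹) atTop
        (𝓝 0) := by
      refine squeeze_zero_norm (fun l => ?_) (a := fun l : ℝ => (‖c‖ + ‖c‖) * ‖(2 * l)⁻¹‖)
        (by simpa using h2.norm.const_mul (‖c‖ + ‖c‖))
      refine (norm_mul_le _ _).trans ?_
      refine mul_le_mul_of_nonneg_right ((norm_sub_le _ _).trans (add_le_add ?_ ?_))
        (norm_nonneg _) <;>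
      exact (Complex.abs_im_le_norm _).trans (Alg.norm_ev_le _ _)
    simpa using h3.const_add δ₀
  refine ⟨Complex.log C • (1 : Alg) + c, ?_⟩
  rw [NormedSpace.exp_add, Alg.exp_smul_one, Complex.exp_log hC, hc, hδ₀, Alg.ap_delta_zero]

/-- The winding number of `χⁿ e^{k̂}` is `n`. -/
theorem winding_eq {f : ℝ → ℂ} {θ : ℝ → ℝ} {θ₁ θ₂ : ℝ} {n : ℤ} {k : LpR 1} (hθ : IsArg f θ)
    (h1 : Tendsto θ atBot (𝓝 θ₁)) (h2 : Tendsto θ atTop (𝓝 θ₂))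
    (hf : ∀ t, f t = chi t ^ n * Complex.exp (evKern t k)) :
    (n : ℝ) = (θ₂ - θ₁) / (2 * Real.pi) := by
  obtain ⟨A, hA⟩ := hθ.exists_eq_add_const
    (θ' := fun t => n * (2 * Real.arctan t - Real.pi) + (evKern t k).im)
    (r := fun t => Real.exp (evKern t k).re)
    ((by fun_prop : Continuous fun t : ℝ => n * (2 * Real.arctan t - Real.pi)).add
      (Complex.continuous_im.comp (continuous_evKern k)))
    (fun t => by positivity) (fun t => by
      rw [hf, chi_eq_exp, ← Complex.exp_int_mul, Complex.ofReal_exp, ← Complex.exp_add,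
        ← Complex.exp_add]
      conv_lhs => rw [← Complex.re_add_im (evKern t k)]
      congr 1
      push_cast
      ring)
  have hlim : ∀ {F : Filter ℝ} (hF : F ≤ cocompact ℝ) {φ : ℝ}, Tendsto Real.arctan F (𝓝 φ) →
      Tendsto θ F (𝓝 (n * (2 * φ - Real.pi) + 0 + A)) := by
    intro F hF φ hφ
    rw [funext hA]
    refine ((((hφ.const_mul 2).sub_const _).const_mul _).add ?_).add_const A
    exact (Complex.continuous_im.tendsto 0).comp ((tendsto_evKern k).mono_left hF)
  have htop := tendsto_nhds_unique h2 (hlim atTop_le_cocompact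
    (Real.tendsto_arctan_atTop.mono_right nhdsWithin_le_nhds))
  have hbot := tendsto_nhds_unique h1 (hlim atBot_le_cocompact
    (Real.tendsto_arctan_atBot.mono_right nhdsWithin_le_nhds))
  rw [htop, hbot, eq_div_iff (by positivity)]
  ring

/-- If `g(t) g(-t) = 1`, `ν(g) = 0` and `n(g) = n`, then `g = χⁿ e^c`. -/
theorem exists_eq_chi_zpow_mul_exp_ev {g : G} (hg : ∀ t : ℝ, g t * g (-t) = 1) (hν : HasNu g 0)
    {n : ℤ} (hn : HasWinding g n) :
    ∃ c : Alg, ∀ t, g t = chi t ^ n * Complex.exp (Alg.ev t c) := by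
  set x := Alg.ofG g with hx
  have hxx : x * Alg.refl x = 1 := Alg.ev_injective fun t => by
    rw [Alg.ev_mul, Alg.ev_refl, hx, Alg.ev_ofG, Alg.ev_ofG, hg, Alg.ev_one]
  set b := Alg.ap (Alg.coef x) with hb
  set b' := Alg.ap (Alg.coef (Alg.refl x)) with hb'
  have hbb : b * b' = 1 := by
    rw [hb, hb', ← Alg.ap_coef_mul, hxx, Alg.coef_one, Alg.ap_delta_zero]
  obtain ⟨c₁, hc₁⟩ := exists_ap_eq_exp hbb hν
  rw [← hx, ← hb] at hc₁
  -- the quotient of `x` by its almost periodic part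
  set y := x * b' with hy
  have hyk : y = 1 + Alg.ofKern (Alg.kern y) := by
    have h1 : Alg.ap (Alg.coef y) = 1 := by
      rw [hy, Alg.ap_coef_mul, ← hb, hb', Alg.coef_ap, ← hb', hbb]
    refine Alg.ext ?_ ?_
    · have := congrArg Alg.coef h1
      rw [Alg.coef_ap] at this
      rw [this, map_add, Alg.coef_ofKern, add_zero]
    · rw [map_add, Alg.kern_one, Alg.kern_ofKern, zero_add]
  have hyv : (1 + Alg.ofKern (Alg.kern y)) * (b * Alg.refl x) = 1 := by
    rw [← hyk, hy]
    linear_combination (b * b') * hxx + hbb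
  obtain ⟨m, l, hml⟩ := Alg.exists_eq_chi_zpow_mul_exp_evKern hyv
  rw [← hyk] at hml
  have hxy : x = y * b := by rw [hy]; linear_combination (-x) * hbb
  have hmn : m = n := by
    obtain ⟨θ, θ₁, θ₂, hθ, h1, h2, h3⟩ := hn
    have h4 := winding_eq (n := m) (k := l) hθ h1 h2 fun t => by
      have hbt : Alg.ev t b = g.apPart t := by rw [hb, Alg.ev_ap, hx, Alg.evCoef_ofG]
      have hb0 : g.apPart t ≠ 0 := by
        intro h0
        have := congrArg (Alg.ev t) hbb
        rw [Alg.ev_mul, hbt, h0, zero_mul, Alg.ev_one] at this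
        exact zero_ne_one this
      have hyb : g.apPart t + g.fourierPart t = Alg.ev t y * g.apPart t := by
        have := congrArg (Alg.ev t) hxy
        rw [Alg.ev_mul, hbt, hx, Alg.ev_ofG] at this
        exact this
      rw [← hml]
      field_simp
      linear_combination hyb
    exact_mod_cast (h4.trans h3.symm)
  subst hmn
  refine ⟨Alg.ofKern l + c₁, fun t => ?_⟩
  rw [← Alg.ev_ofG, ← hx, hxy, Alg.ev_mul, hml, hc₁, Alg.ev_exp, map_add, Alg.ev_ofKern,
    Complex.exp_add, mul_assoc]

/-- A function of the form `χ⁻¹ e^c` has a factorization: `c` is the sum of one-sided elements. -/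
theorem exists_isFactorization {g : G} {c : Alg}
    (h : ∀ t, g t = chi t ^ (-1 : ℤ) * Complex.exp (Alg.ev t c)) :
    ∃ gm gmInv gp gpInv : G, IsFactorization g 0 (-1) gm gmInv gp gpInv ∧ gm 0 = 1 := by
  obtain ⟨y, z, hy, hz, rfl⟩ := Alg.exists_plus_add_minus c
  set z₀ : ℂ := Alg.ev 0 z
  have hplus : ∀ w : Alg, w ∈ Alg.plus → (NormedSpace.exp w).toG.IsPlus := fun w hw => by
    rw [← Alg.mem_plus_ofG, Alg.ofG_toG]
    exact Alg.exp_mem Alg.isClosed_plus hw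
  have hminus : ∀ w : Alg, Alg.refl w ∈ Alg.plus → (NormedSpace.exp w).toG.IsMinus := fun w hw => by
    rw [← Alg.refl_mem_plus_ofG, Alg.ofG_toG, Alg.refl_exp]
    exact Alg.exp_mem Alg.isClosed_plus hw
  have hinv : ∀ (w : Alg) (t : ℝ), (NormedSpace.exp w).toG t * (NormedSpace.exp (-w)).toG t = 1 :=
    fun w t => by
      rw [Alg.toG_apply, Alg.toG_apply, Alg.ev_exp, Alg.ev_exp, ← Complex.exp_add, map_neg,
        add_neg_cancel, Complex.exp_zero]
  -- the constant `z₀` is moved to the other factor, to normalize the first one at `0`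
  set zm : Alg := z - z₀ • (1 : Alg) with hzm
  set yp : Alg := y + z₀ • (1 : Alg) with hyp
  have hzm' : Alg.refl zm ∈ Alg.plus := by
    have : Alg.refl zm = Alg.refl z - z₀ • (1 : Alg) := Alg.ev_injective fun t => by
      simp [hzm, Alg.ev_refl]
    rw [this]
    exact sub_mem hz (Alg.plus.smul_mem (one_mem _) _)
  have hzmn : Alg.refl (-zm) ∈ Alg.plus := by
    have : Alg.refl (-zm) = -Alg.refl zm := Alg.ev_injective fun t => by
      simp [Alg.ev_refl]
    rw [this]
    exact neg_mem hzm'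
  have hyp' : yp ∈ Alg.plus := add_mem hy (Alg.plus.smul_mem (one_mem _) _)
  refine ⟨(NormedSpace.exp zm).toG, (NormedSpace.exp (-zm)).toG, (NormedSpace.exp yp).toG,
    (NormedSpace.exp (-yp)).toG,
    ⟨hminus _ hzm', hminus _ hzmn, hinv zm, hplus _ hyp', hplus _ (neg_mem hyp'), hinv yp,
      fun t => ?_⟩, ?_⟩
  · rw [h, Alg.toG_apply, Alg.toG_apply, Alg.ev_exp, Alg.ev_exp, Complex.ofReal_zero, mul_zero,
      zero_mul, Complex.exp_zero, mul_one, mul_comm (Complex.exp _) (chi t ^ (-1 : ℤ)), mul_assoc,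
      ← Complex.exp_add, ← map_add, hzm, hyp]
    congr 3
    abel
  · rw [Alg.toG_apply, Alg.ev_exp, hzm, map_sub, map_smul, Alg.ev_one, smul_eq_mul, mul_one,
      sub_self, Complex.exp_zero]

end

end WienerHopf

theorem theorem4 (p : ℝ≥0∞) [Fact (1 ≤ p)] (g : G)
    (hg : ∀ t : ℝ, g t * g (-t) = 1) (hν : HasNu g 0) (hn : HasWinding g (-1)) :
    (∃ gm gmInv gp gpInv : G, IsFactorization g 0 (-1) gm gmInv gp gpInv ∧ gm 0 = 1) ∧
    ∀ gm gmInv gp gpInv : G, IsFactorization g 0 (-1) gm gmInv gp gpInv →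
      Module.finrank ℂ (kerW p g) = 1 ∧
      kerW p g = Submodule.span ℂ {W p gpInv (psi0 p)} ∧
      LinearMap.range (boldPPlus p g) =
        Submodule.span ℂ {((1 - xi g (-1)) / 2) • W p gpInv (psi0 p)} ∧
      LinearMap.range (boldPMinus p g) =
        Submodule.span ℂ {((1 + xi g (-1)) / 2) • W p gpInv (psi0 p)} := by
  obtain ⟨c, hc⟩ := exists_eq_chi_zpow_mul_exp_ev hg hν hn
  exact ⟨exists_isFactorization hc, fun _ _ _ _ hF => kernel_of_factorization p hg hF⟩
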